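/- Let \[\alpha = 2\pi\prod_p\frac{1-p-2p^2+p^4}{p^4-2p^2+p},\qquad \beta=2\pi\prod_p\frac{-1+p^2+p^3}{p(-1+p+p^2)},\qquad \gamma=12\prod_p\frac{p(1+p)}{-1+p+p^2},\] \[\nu(r)=\prod_{p\mid r}\Big(1+\frac{p^2}{p^4-2p^2-p+1}\Big),\qquad Q(d)=\mu^2(d)\prod_{p\mid d}\frac{p^2}{p^4-2p^2-p+1},\] the products running over primes. Let $U_n$ be the Chebyshev polynomial with $U_n(\cos\theta)=\sin((n+1)\theta)/\sin\theta$ and $J_n$ the Bessel function of the first kind. For an even integer $k>0$ and real $y\ge 0$, let the weight $k$ murmuration density be \[\mathcal M_k(y)=\frac{\alpha(-1)^{k/2-1}}{k-1}\sum_{1\le r\le 2\sqrt y}\nu(r)\sqrt{4y-r^2}\,U_{k-2}\Big(\frac{r}{2\sqrt y}\Big)+\frac{\beta}{k-1}\sqrt y-\gamma\,\delta_{k=2}\,y .\] Then, for every even $k>0$: (1) For every $y\ge 0$, \[\mathcal M_k(y)=\alpha\sqrt y\sum_{d,s\ge 1}Q(d)\,\frac{J_{k-1}(4\pi s\sqrt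 y/d)}{s},\] where the double series converges absolutely. (2) $Q(d)\asymp\mu^2(d)/d^2$ for $d\ge 1$. (3) As $y\to\infty$, \[\mathcal M_k(y)=y^{1/4}\,\frac{(-1)^{k/2-1}\alpha}{\sqrt2\,\pi}\sum_{d,s\ge 1}\frac{Q(d)\sqrt d}{s^{3/2}}\cos\Big(\frac{4\pi s\sqrt y}{d}-\frac{3\pi}{4}\Big)+O(1),\] where the implied constant may depend on $k$. (4) The double series in (3) converges absolutely for every $y\ge 0$, converges uniformly in $y\ge 0$, and its sum is bounded uniformly in $y\ge 0$. -/

import Mathlib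

open Filter Asymptotics

noncomputable section

namespace Murmuration

/-- The Bessel function of the first kind `J_n` of integer order `n`, through Bessel's integral
`J_n(x) = (1/π) ∫_0^π cos (n θ - x sin θ) dθ`. -/
def besselJ (n : ℤ) (x : ℝ) : ℝ :=
  (1 / Real.pi) * ∫ θ in (0 : ℝ)..Real.pi, Real.cos ((n : ℝ) * θ - x * Real.sin θ)

/-- The local factor `p² / (p⁴ - 2 p² - p + 1)`. -/
def localQ (p : ℕ) : ℝ :=
  (p : ℝ) ^ 2 / ((p : ℝ) ^ 4 - 2 * (p : ℝ) ^ 2 - (p : ℝ) + 1)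

/-- `Q(d) = μ²(d) ∏_{p ∣ d} p² / (p⁴ - 2 p² - p + 1)`. -/
def Q (d : ℕ) : ℝ :=
  (ArithmeticFunction.moebius d : ℝ) ^ 2 * ∏ p ∈ d.primeFactors, localQ p

/-- `ν(r) = ∏_{p ∣ r} (1 + p² / (p⁴ - 2 p² - p + 1))`. -/
def nu (r : ℕ) : ℝ :=
  ∏ p ∈ r.primeFactors, (1 + localQ p)

/-- `α = 2π ∏_p (1 - p - 2 p² + p⁴) / (p⁴ - 2 p² + p)`. -/
def alpha : ℝ :=
  2 * Real.pi * ∏' p : Nat.Primes,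
    (1 - (p : ℝ) - 2 * (p : ℝ) ^ 2 + (p : ℝ) ^ 4) / ((p : ℝ) ^ 4 - 2 * (p : ℝ) ^ 2 + (p : ℝ))

/-- `β = 2π ∏_p (-1 + p² + p³) / (p (-1 + p + p²))`. -/
def beta : ℝ :=
  2 * Real.pi * ∏' p : Nat.Primes,
    (-1 + (p : ℝ) ^ 2 + (p : ℝ) ^ 3) / ((p : ℝ) * (-1 + (p : ℝ) + (p : ℝ) ^ 2))

/-- `γ = 12 ∏_p p (1 + p) / (-1 + p + p²)`. -/
def gamma : ℝ :=
  12 * ∏' p : Nat.Primes,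
    ((p : ℝ) * (1 + (p : ℝ))) / (-1 + (p : ℝ) + (p : ℝ) ^ 2)

/-- The weight `k` murmuration density (for even `k > 0`). The sum runs over the integers
`1 ≤ r ≤ 2 √y`, and `U_{k-2}` is the Chebyshev polynomial of the second kind. -/
def density (k : ℕ) (y : ℝ) : ℝ :=
  alpha * (-1) ^ (k / 2 - 1) / ((k : ℝ) - 1) *
      ∑ r ∈ Finset.Icc 1 ⌊2 * √y⌋₊,
        nu r * √(4 * y - (r : ℝ) ^ 2) *
          (Polynomial.Chebyshev.U ℝ ((k : ℤ) - 2)).eval ((r : ℝ) / (2 * √y))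
    + beta / ((k : ℝ) - 1) * √y
    - gamma * (if k = 2 then 1 else 0) * y

/-- The general term `Q(d) J_{k-1}(4 π s √y / d) / s` of the Bessel expansion. -/
def besselTerm (k : ℕ) (y : ℝ) (d s : ℕ+) : ℝ :=
  Q d * (besselJ ((k : ℤ) - 1) (4 * Real.pi * (s : ℝ) * √y / (d : ℝ)) / (s : ℝ))

/-- The general term `Q(d) √d s^{-3/2} cos (4 π s √y / d - 3 π / 4)` of the asymptotic expansion. -/
def cosTerm (y : ℝ) (d s : ℕ+) : ℝ :=
  Q d * √(d : ℝ) / (s : ℝ) ^ (3 / 2 : ℝ) *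
    Real.cos (4 * Real.pi * (s : ℝ) * √y / (d : ℝ) - 3 * Real.pi / 4)

end Murmuration

end

/-!
The arithmetic weight is a divisor sum, `ν(r) = ∑_{d ∣ r} Q(d)` (`nu_eq_sum_divisors`), so the
density is a sum over `d` of the Chebyshev summand `wave` sampled at the multiples of `d`. In the
coordinate `r = 2 √y cos θ` this summand is `2 √y sin ((k - 1) θ)`; it is even and continuous with
compact support, and an integration by parts together with a shift by `π / 2` turns its Fourier
transform into `J_{k-1}(x) / x` (`fourier_wave`, `waveFourier_eq_besselJ`). Poisson summation
(`tsum_wave`) then produces the Bessel series. The frequency `0`, present only for `k = 2`, and the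
value at the origin contribute `π α y ∑ Q(d) / d` and `-α √y ∑ Q(d) / (k - 1)`, and comparison of
Euler products identifies these with `γ y` and `-β √y / (k - 1)` (`gamma_eq`, `beta_eq`).

Everything analytic rests on the asymptotics of `J_n` with error `O(x ^ (-3/2))`
(`exists_abs_besselJ_sub_le`). For `J₀ + i J₁ = π⁻¹ ∫₀^π e^{i x cos θ} (1 + cos θ) dθ` one writes
`1 + cos θ = 2 cos (θ / 2) - tan (θ / 4) sin θ`. The first part is exactly a truncated Fresnel
integral in `v = 2 sin (θ / 2)`; the second is integrated by parts. The boundary terms of order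
`1 / x` cancel, and the remaining oscillatory integral is `O(x ^ (-1/2))` by van der Corput's
method. The three-term recurrence gives all other orders.

In the asymptotics of the density the error of the term `(d, s)` is summed using both its behaviour
`x ^ (-1/2)` for small `x = 4 π s √y / d` and `x ^ (-3/2)` for large `x`; since `Q(d) ≪ d⁻²`, the
sum over `d` is `O(1 / (s √y))`, with an elementary telescoping majorant
(`sum_pnat_inv_sqrt_mul_sq_le`), and the factor `√y` in front is absorbed.
-/

namespace Murmuration

/-! ### Fresnel integrals -/

section Fresnel

open MeasureTheory Set Topology intervalIntegral

theorem norm_cexp_neg_mul_sq_div_two_le {z : ℂ} (hz : 0 ≤ z.re) (v : ℝ) :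
    ‖Complex.exp (-z * (v : ℂ) ^ 2 / 2)‖ ≤ 1 := by
  rw [Complex.norm_exp, Real.exp_le_one_iff]
  have : (-z * (v : ℂ) ^ 2 / 2).re = -(z.re * v ^ 2 / 2) := by
    rw [← Complex.ofReal_pow, show -z * ((v ^ 2 : ℝ) : ℂ) / 2 = ((-(v ^ 2) / 2 : ℝ) : ℂ) * z by
      push_cast; ring, Complex.re_ofReal_mul]
    ring
  rw [this]
  have := mul_nonneg hz (sq_nonneg v)
  linarith

theorem hasDerivAt_cexp_neg_mul_sq_div_two (z : ℂ) (v : ℝ) :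
    HasDerivAt (fun v : ℝ => Complex.exp (-z * (v : ℂ) ^ 2 / 2))
      (Complex.exp (-z * (v : ℂ) ^ 2 / 2) * (-z * v)) v := by
  have h : HasDerivAt (fun w : ℂ => Complex.exp (-z * w ^ 2 / 2))
      (Complex.exp (-z * (v : ℂ) ^ 2 / 2) * (-z * v)) (v : ℂ) := by
    refine (((hasDerivAt_pow 2 (v : ℂ)).const_mul (-z)).div_const 2).cexp.congr_deriv ?_
    push_cast
    ring
  exact h.comp_ofReal

/-- The majorant of the integral left over by `fresnel_integration_by_parts`. -/
theorem intervalIntegral_inv_pow_add_two {a T : ℝ} (ha : 0 < a) (haT : a ≤ T) (m : ℕ) :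
    ∫ v in a..T, ((m : ℝ) + 1) / v ^ (m + 2) = 1 / a ^ (m + 1) - 1 / T ^ (m + 1) := by
  have hpos : ∀ v ∈ uIcc a T, v ≠ 0 := fun v hv => by
    rw [uIcc_of_le haT] at hv
    exact (ha.trans_le hv.1).ne'
  rw [integral_eq_sub_of_hasDerivAt (f := fun v => -(1 / v ^ (m + 1)))]
  · ring
  · intro v hv
    have h0 := hpos v hv
    simp only [one_div]
    refine ((hasDerivAt_pow (m + 1) v).fun_inv (pow_ne_zero _ h0)).fun_neg.congr_deriv ?_
    rw [Nat.add_sub_cancel]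
    field_simp
    push_cast
    ring
  · refine ContinuousOn.intervalIntegrable fun v hv => ?_
    exact (continuousAt_const.div (continuousAt_id.pow _)
      (pow_ne_zero _ (hpos v hv))).continuousWithinAt

/-- One integration by parts of the truncated Fresnel integral with weight `v⁻ᵐ`. -/
theorem fresnel_integration_by_parts {z : ℂ} (hz0 : z ≠ 0) {a T : ℝ} (ha : 0 < a) (haT : a ≤ T)
    (m : ℕ) :
    ∫ v in a..T, Complex.exp (-z * (v : ℂ) ^ 2 / 2) / (v : ℂ) ^ m =
      Complex.exp (-z * (a : ℂ) ^ 2 / 2) / (z * (a : ℂ) ^ (m + 1)) -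
        Complex.exp (-z * (T : ℂ) ^ 2 / 2) / (z * (T : ℂ) ^ (m + 1)) -
        ((m : ℂ) + 1) / z *
          ∫ v in a..T, Complex.exp (-z * (v : ℂ) ^ 2 / 2) / (v : ℂ) ^ (m + 2) := by
  have hpos : ∀ v ∈ uIcc a T, (v : ℂ) ≠ 0 := fun v hv => by
    rw [uIcc_of_le haT] at hv
    exact_mod_cast (ha.trans_le hv.1).ne'
  have hcont : ∀ l : ℕ, ContinuousOn
      (fun v : ℝ => Complex.exp (-z * (v : ℂ) ^ 2 / 2) / (v : ℂ) ^ l) (uIcc a T) := by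
    intro l v hv
    refine ContinuousAt.continuousWithinAt (ContinuousAt.div ?_ ?_ (pow_ne_zero _ (hpos v hv)))
    · fun_prop
    · fun_prop
  have hd : ∀ v ∈ uIcc a T, HasDerivAt
      (fun v : ℝ => -(Complex.exp (-z * (v : ℂ) ^ 2 / 2) / (z * (v : ℂ) ^ (m + 1))))
      (Complex.exp (-z * (v : ℂ) ^ 2 / 2) / (v : ℂ) ^ m +
        ((m : ℂ) + 1) / z * (Complex.exp (-z * (v : ℂ) ^ 2 / 2) / (v : ℂ) ^ (m + 2))) v := by
    intro v hv
    have h0 := hpos v hv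
    have h1 : HasDerivAt (fun v : ℝ => z * (v : ℂ) ^ (m + 1))
        (z * (((m + 1 : ℕ) : ℂ) * (v : ℂ) ^ m)) v := by
      have := ((hasDerivAt_pow (m + 1) (v : ℂ)).const_mul z).comp_ofReal
      simpa using this
    refine ((hasDerivAt_cexp_neg_mul_sq_div_two z v).fun_div h1
      (mul_ne_zero hz0 (pow_ne_zero _ h0))).fun_neg.congr_deriv ?_
    field_simp
    push_cast
    ring
  have key := integral_eq_sub_of_hasDerivAt hd
    (((hcont m).add (continuousOn_const.mul (hcont (m + 2)))).intervalIntegrable)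
  rw [intervalIntegral.integral_add (hcont m).intervalIntegrable
    ((hcont (m + 2)).intervalIntegrable.const_mul _),
    intervalIntegral.integral_const_mul] at key
  linear_combination key

/-- The two boundary terms and the remaining integral of `fresnel_integration_by_parts` add up to
`2 / (‖z‖ a ^ (m + 1))`, whatever the upper end `T`. -/
theorem norm_fresnel_tail_le {z : ℂ} (hz0 : z ≠ 0) (hz : 0 ≤ z.re) {a T : ℝ} (ha : 0 < a)
    (haT : a ≤ T) (m : ℕ) :
    ‖∫ v in a..T, Complex.exp (-z * (v : ℂ) ^ 2 / 2) / (v : ℂ) ^ m‖ ≤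
      2 / (‖z‖ * a ^ (m + 1)) := by
  have hzn : 0 < ‖z‖ := norm_pos_iff.2 hz0
  have hT : 0 < T := ha.trans_le haT
  rw [fresnel_integration_by_parts hz0 ha haT m]
  have hb : ∀ v : ℝ, 0 < v → ‖Complex.exp (-z * (v : ℂ) ^ 2 / 2) / (z * (v : ℂ) ^ (m + 1))‖ ≤
      1 / (‖z‖ * v ^ (m + 1)) := by
    intro v hv
    rw [norm_div, norm_mul, norm_pow, Complex.norm_real, Real.norm_of_nonneg hv.le]
    gcongr
    exact norm_cexp_neg_mul_sq_div_two_le hz v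
  have hi : ‖((m : ℂ) + 1) / z *
      ∫ v in a..T, Complex.exp (-z * (v : ℂ) ^ 2 / 2) / (v : ℂ) ^ (m + 2)‖ ≤
      1 / ‖z‖ * (1 / a ^ (m + 1) - 1 / T ^ (m + 1)) := by
    rw [← intervalIntegral_inv_pow_add_two ha haT m, ← intervalIntegral.integral_const_mul,
      ← intervalIntegral.integral_const_mul]
    refine norm_integral_le_of_norm_le haT ?_ ?_
    · refine Eventually.of_forall fun v hv => ?_
      have hv0 : 0 < v := ha.trans hv.1
      rw [norm_mul, norm_div, norm_div, norm_pow, Complex.norm_real, Real.norm_of_nonneg hv0.le]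
      have h1 : ‖(m : ℂ) + 1‖ = (m : ℝ) + 1 := by
        have : ((m : ℂ) + 1) = (((m : ℝ) + 1 : ℝ) : ℂ) := by push_cast; ring
        rw [this, Complex.norm_real, Real.norm_of_nonneg (by positivity)]
      rw [h1]
      have := norm_cexp_neg_mul_sq_div_two_le hz v
      calc ((m : ℝ) + 1) / ‖z‖ * (‖Complex.exp (-z * (v : ℂ) ^ 2 / 2)‖ / v ^ (m + 2))
          ≤ ((m : ℝ) + 1) / ‖z‖ * (1 / v ^ (m + 2)) := by gcongr
        _ = 1 / ‖z‖ * (((m : ℝ) + 1) / v ^ (m + 2)) := by ring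
    · refine (continuousOn_const.mul fun v hv => ?_).intervalIntegrable
      rw [uIcc_of_le haT] at hv
      exact (continuousAt_const.div (continuousAt_id.pow _)
        (pow_ne_zero _ (ha.trans_le hv.1).ne')).continuousWithinAt
  have h1 := hb a ha
  have h2 := hb T hT
  refine (norm_sub_le _ _).trans ((add_le_add ((norm_sub_le _ _).trans (add_le_add h1 h2)) hi).trans
    (le_of_eq ?_))
  field_simp
  ring

/-- The truncated Fresnel integrals are `O(X ^ (-1/2))`, uniformly in the truncation. -/
theorem norm_fresnel_le {X : ℝ} (hX : 0 < X) {T : ℝ} (hT : 0 ≤ T) :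
    ‖∫ v in (0 : ℝ)..T, Complex.exp (-(Complex.I * X) * (v : ℂ) ^ 2 / 2)‖ ≤ 3 / √X := by
  have hs : 0 < √X := Real.sqrt_pos.2 hX
  have hre : (Complex.I * X).re = 0 := by simp
  -- Below the scale `1 / √X` of the first oscillation the integrand is bounded by `1`.
  have triv : ∀ b : ℝ, 0 ≤ b → b ≤ 1 / √X →
      ‖∫ v in (0 : ℝ)..b, Complex.exp (-(Complex.I * X) * (v : ℂ) ^ 2 / 2)‖ ≤ 1 / √X := by
    intro b hb hb'
    have := norm_integral_le_of_norm_le_const (a := 0) (b := b) (C := 1)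
      (f := fun v : ℝ => Complex.exp (-(Complex.I * X) * (v : ℂ) ^ 2 / 2))
      (fun v _ => norm_cexp_neg_mul_sq_div_two_le hre.ge v)
    rw [sub_zero, abs_of_nonneg hb, one_mul] at this
    exact this.trans hb'
  rcases le_total T (1 / √X) with h | h
  · exact (triv T hT h).trans (by gcongr; norm_num)
  · have hI : ∀ a b : ℝ, IntervalIntegrable
        (fun v : ℝ => Complex.exp (-(Complex.I * X) * (v : ℂ) ^ 2 / 2)) volume a b :=
      fun a b => (by fun_prop : Continuous _).intervalIntegrable _ _
    rw [← integral_add_adjacent_intervals (hI 0 (1 / √X)) (hI (1 / √X) T)]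
    have h1 := triv (1 / √X) (by positivity) le_rfl
    have h2 := norm_fresnel_tail_le (z := Complex.I * X) (by simp [hX.ne']) hre.ge
      (by positivity) h 0
    have h3 : 2 / (‖Complex.I * (X : ℂ)‖ * (1 / √X) ^ (0 + 1)) = 2 / √X := by
      rw [norm_mul, Complex.norm_I, Complex.norm_real, Real.norm_of_nonneg hX.le]
      nth_rw 1 [← Real.mul_self_sqrt hX.le]
      rw [zero_add, pow_one]
      field_simp
    rw [h3] at h2
    simp only [pow_zero, div_one] at h2
    calc _ ≤ 1 / √X + 2 / √X := (norm_add_le _ _).trans (add_le_add h1 h2)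
      _ = 3 / √X := by ring

/-- The Gaussian integral over `(2, ∞)` is its first boundary term up to `O(‖z‖⁻²)`, uniformly in
`0 < re z`, so that the estimate passes to the imaginary axis. -/
theorem norm_fresnel_two_sub_le_of_re_pos {z : ℂ} (hz : 0 < z.re) :
    ‖(Real.pi / (z / 2)) ^ (1 / 2 : ℂ) / 2 -
      (∫ v in (0 : ℝ)..2, Complex.exp (-z * (v : ℂ) ^ 2 / 2)) -
        Complex.exp (-2 * z) / (2 * z)‖ ≤ 1 / (4 * ‖z‖ ^ 2) := by
  have hz0 : z ≠ 0 := by rintro rfl; simp at hz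
  have hzn : 0 < ‖z‖ := norm_pos_iff.2 hz0
  have hI : ∀ a b : ℝ, IntervalIntegrable
      (fun v : ℝ => Complex.exp (-z * (v : ℂ) ^ 2 / 2)) volume a b :=
    fun a b => (by fun_prop : Continuous _).intervalIntegrable _ _
  -- Two integrations by parts on `[2, T]`.
  have hfin : ∀ T : ℝ, 2 ≤ T →
      ‖(∫ v in (0 : ℝ)..T, Complex.exp (-z * (v : ℂ) ^ 2 / 2)) -
        (∫ v in (0 : ℝ)..2, Complex.exp (-z * (v : ℂ) ^ 2 / 2)) -
        Complex.exp (-2 * z) / (2 * z) + Complex.exp (-z * (T : ℂ) ^ 2 / 2) / (z * T)‖ ≤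
          1 / (4 * ‖z‖ ^ 2) := by
    intro T hT
    have h1 := fresnel_integration_by_parts hz0 two_pos hT 0
    have h2 := norm_fresnel_tail_le hz0 hz.le two_pos hT 2
    simp only [pow_zero, div_one, zero_add, pow_one, Nat.cast_zero, Complex.ofReal_ofNat] at h1
    rw [← integral_add_adjacent_intervals (hI 0 2) (hI 2 T), h1]
    rw [show -z * 2 ^ 2 / 2 = -2 * z by ring]
    have h3 : ∀ A B C D : ℂ, A + (B / (z * 2) - C - 1 / z * D) - A - B / (2 * z) + C =
        -(1 / z * D) := by intro A B C D; ring
    rw [h3, norm_neg, norm_mul, norm_div, norm_one]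
    calc _ ≤ 1 / ‖z‖ * (2 / (‖z‖ * 2 ^ (2 + 1))) := by gcongr
      _ = 1 / (4 * ‖z‖ ^ 2) := by field_simp; norm_num
  have hb : 0 < (z / 2).re := by
    rw [show z / 2 = ((1 / 2 : ℝ) : ℂ) * z by push_cast; ring, Complex.re_ofReal_mul]
    positivity
  have hcongr : (fun v : ℝ => Complex.exp (-(z / 2) * (v : ℂ) ^ 2)) =
      fun v : ℝ => Complex.exp (-z * (v : ℂ) ^ 2 / 2) := by
    funext v
    congr 1
    ring
  have hlim1 : Tendsto (fun T : ℝ => ∫ v in (0 : ℝ)..T, Complex.exp (-z * (v : ℂ) ^ 2 / 2)) atTop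
      (𝓝 ((Real.pi / (z / 2)) ^ (1 / 2 : ℂ) / 2)) := by
    rw [← integral_gaussian_complex_Ioi hb, hcongr]
    refine intervalIntegral_tendsto_integral_Ioi 0 ?_ tendsto_id
    rw [← hcongr]
    exact (integrable_cexp_neg_mul_sq hb).integrableOn
  have hlim2 : Tendsto (fun T : ℝ => Complex.exp (-z * (T : ℂ) ^ 2 / 2) / (z * T)) atTop
      (𝓝 0) := by
    refine squeeze_zero_norm' (a := fun T : ℝ => ‖z‖⁻¹ * T⁻¹) ?_ ?_
    · filter_upwards [eventually_gt_atTop 0] with T hT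
      rw [norm_div, norm_mul, Complex.norm_real, Real.norm_of_nonneg hT.le, ← mul_inv, ← one_div]
      gcongr
      exact norm_cexp_neg_mul_sq_div_two_le hz.le T
    · simpa using tendsto_inv_atTop_zero.const_mul ‖z‖⁻¹
  have hlim := ((((hlim1.sub_const
    (∫ v in (0 : ℝ)..2, Complex.exp (-z * (v : ℂ) ^ 2 / 2))).sub_const
    (Complex.exp (-2 * z) / (2 * z))).add hlim2)).norm
  rw [add_zero] at hlim
  refine le_of_tendsto hlim ?_
  filter_upwards [eventually_ge_atTop 2] with T hT
  exact hfin T hT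

theorem cpow_half_pi_div_I_mul {X : ℝ} (hX : 0 < X) :
    ((Real.pi : ℂ) / (Complex.I * X / 2)) ^ (1 / 2 : ℂ) =
      (√(2 * Real.pi / X) : ℝ) * Complex.exp (-(Complex.I * (Real.pi / 4))) := by
  have hx : (X : ℂ) ≠ 0 := by exact_mod_cast hX.ne'
  have h1 : ((Real.pi : ℂ) / (Complex.I * X / 2)) =
      ((2 * Real.pi / X : ℝ) : ℂ) * (-Complex.I) := by
    push_cast
    field_simp
    simp
  have hpos : 0 < 2 * Real.pi / X := by positivity
  rw [h1, Complex.cpow_def_of_ne_zero (mul_ne_zero (by exact_mod_cast hpos.ne')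
    (neg_ne_zero.2 Complex.I_ne_zero)),
    Complex.log_ofReal_mul hpos (neg_ne_zero.2 Complex.I_ne_zero),
    Complex.log_neg_I, Real.sqrt_eq_rpow, Real.rpow_def_of_pos hpos, Complex.ofReal_exp,
    ← Complex.exp_add]
  congr 1
  push_cast
  ring

/-- The Fresnel integral over `[0, 2]`: its value over `(0, ∞)`, the boundary term at `2`, and an
error `O(X⁻²)`. It is the limit `re z → 0` of `norm_fresnel_two_sub_le_of_re_pos`. -/
theorem norm_fresnel_two_sub_le {X : ℝ} (hX : 0 < X) :
    ‖(√(2 * Real.pi / X) : ℝ) * Complex.exp (-(Complex.I * (Real.pi / 4))) / 2 -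
      (∫ v in (0 : ℝ)..2, Complex.exp (-(Complex.I * X) * (v : ℂ) ^ 2 / 2)) -
        Complex.exp (-2 * (Complex.I * X)) / (2 * (Complex.I * X))‖ ≤ 1 / (4 * X ^ 2) := by
  have hx : (X : ℂ) ≠ 0 := by exact_mod_cast hX.ne'
  rw [← cpow_half_pi_div_I_mul hX]
  set z : ℝ → ℂ := fun ε => ε + Complex.I * X with hz
  have hz0 : z 0 = Complex.I * X := by simp [hz]
  have hzc : Continuous z := by fun_prop
  have hzne : z 0 ≠ 0 := by simp [hz0, hX.ne']
  have hcont : ContinuousAt (fun ε : ℝ => ‖(Real.pi / (z ε / 2)) ^ (1 / 2 : ℂ) / 2 -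
      (∫ v in (0 : ℝ)..2, Complex.exp (-z ε * (v : ℂ) ^ 2 / 2)) -
        Complex.exp (-2 * z ε) / (2 * z ε)‖) 0 := by
    refine ((ContinuousAt.sub (ContinuousAt.sub (ContinuousAt.div_const ?_ _) ?_) ?_)).norm
    · refine ContinuousAt.cpow (continuousAt_const.div (by fun_prop) ?_) continuousAt_const ?_
      · simpa using hzne
      · rw [hz0, Complex.mem_slitPlane_iff]
        right
        rw [show (Real.pi : ℂ) / (Complex.I * X / 2) = ((2 * Real.pi / X : ℝ) : ℂ) * (-Complex.I) by
          push_cast; field_simp; simp, Complex.im_ofReal_mul]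
        simp [Real.pi_ne_zero, hX.ne']
    · have : Continuous fun ε : ℝ => ∫ v in (0 : ℝ)..2, Complex.exp (-z ε * (v : ℂ) ^ 2 / 2) :=
        continuous_parametric_intervalIntegral_of_continuous' (by fun_prop) 0 2
      exact this.continuousAt
    · exact ContinuousAt.div (by fun_prop) (by fun_prop) (by simpa using hzne)
  have hcont2 : ContinuousAt (fun ε : ℝ => 1 / (4 * ‖z ε‖ ^ 2)) 0 := by
    refine continuousAt_const.div (by fun_prop) ?_
    simpa using hzne
  have hle := le_of_tendsto_of_tendsto (hcont.tendsto.mono_left (nhdsWithin_le_nhds (s := Ioi 0)))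
    (hcont2.tendsto.mono_left nhdsWithin_le_nhds) (by
      filter_upwards [self_mem_nhdsWithin] with ε hε
      exact norm_fresnel_two_sub_le_of_re_pos (by simpa [hz] using hε))
  rw [hz0] at hle
  simpa [abs_of_pos hX] using hle

end Fresnel

/-! ### Bessel's integral -/

section BesselIntegral

open MeasureTheory Set Topology intervalIntegral

theorem integral_zero_pi_eq_zero_of_reflect {f : ℝ → ℝ} (hf : ∀ θ, f (Real.pi - θ) = -f θ) :
    ∫ θ in (0 : ℝ)..Real.pi, f θ = 0 := by
  have h := intervalIntegral.integral_comp_sub_left (a := 0) (b := Real.pi) f Real.pi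
  rw [sub_self, sub_zero] at h
  simp only [hf, intervalIntegral.integral_neg] at h
  linarith

theorem integral_zero_pi_shift {f : ℝ → ℝ} (hf : Function.Periodic f Real.pi) :
    ∫ θ in (0 : ℝ)..Real.pi, f (θ - Real.pi / 2) = ∫ θ in (0 : ℝ)..Real.pi, f θ := by
  have h := hf.intervalIntegral_add_eq (-(Real.pi / 2)) 0
  rw [zero_add] at h
  rw [← h, intervalIntegral.integral_comp_sub_right]
  congr 1 <;> ring

/-- The three-term recurrence of the Bessel functions: the derivative of
`sin ((n + 1) θ - x sin θ)` integrates to zero over `[0, π]`. -/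
theorem besselJ_recurrence (n : ℤ) (x : ℝ) :
    x * (besselJ (n + 2) x + besselJ n x) = 2 * ((n : ℝ) + 1) * besselJ (n + 1) x := by
  have hd : ∀ θ : ℝ, HasDerivAt (fun θ : ℝ => Real.sin (((n : ℝ) + 1) * θ - x * Real.sin θ))
      (((n : ℝ) + 1) * Real.cos (((n : ℝ) + 1) * θ - x * Real.sin θ) -
        x * Real.cos θ * Real.cos (((n : ℝ) + 1) * θ - x * Real.sin θ)) θ := by
    intro θ
    refine ((((hasDerivAt_id θ).const_mul ((n : ℝ) + 1)).sub
      ((Real.hasDerivAt_sin θ).const_mul x)).sin).congr_deriv ?_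
    simp
    ring
  have hI := integral_eq_sub_of_hasDerivAt (a := 0) (b := Real.pi) (fun θ _ => hd θ)
    ((by fun_prop : Continuous _).intervalIntegrable _ _)
  have hs : Real.sin (((n : ℝ) + 1) * Real.pi) = 0 := by
    have := Real.sin_int_mul_pi (n + 1)
    push_cast at this
    exact this
  rw [intervalIntegral.integral_sub ((by fun_prop : Continuous _).intervalIntegrable _ _)
    ((by fun_prop : Continuous _).intervalIntegrable _ _)] at hI
  simp only [Real.sin_pi, mul_zero, sub_zero, hs, Real.sin_zero, mul_assoc x,
    intervalIntegral.integral_const_mul] at hI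
  unfold besselJ
  push_cast
  have hsum : (∫ θ in (0 : ℝ)..Real.pi, Real.cos (((n : ℝ) + 2) * θ - x * Real.sin θ)) +
      (∫ θ in (0 : ℝ)..Real.pi, Real.cos ((n : ℝ) * θ - x * Real.sin θ)) =
      2 * ∫ θ in (0 : ℝ)..Real.pi,
        Real.cos θ * Real.cos (((n : ℝ) + 1) * θ - x * Real.sin θ) := by
    rw [← intervalIntegral.integral_add ((by fun_prop : Continuous _).intervalIntegrable _ _)
      ((by fun_prop : Continuous _).intervalIntegrable _ _),
      ← intervalIntegral.integral_const_mul]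
    refine intervalIntegral.integral_congr fun θ _ => ?_
    have h1 : ((n : ℝ) + 2) * θ - x * Real.sin θ =
      (((n : ℝ) + 1) * θ - x * Real.sin θ) + θ := by ring
    have h2 : (n : ℝ) * θ - x * Real.sin θ =
      (((n : ℝ) + 1) * θ - x * Real.sin θ) - θ := by ring
    simp only [h1, h2, Real.cos_add, Real.cos_sub]
    ring
  linear_combination (x * (1 / Real.pi)) * hsum - 2 * (1 / Real.pi) * hI

theorem abs_besselJ_le_one (n : ℤ) (x : ℝ) : |besselJ n x| ≤ 1 := by
  unfold besselJ
  have h := norm_integral_le_of_norm_le_const (a := 0) (b := Real.pi) (C := 1)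
    (f := fun θ : ℝ => Real.cos ((n : ℝ) * θ - x * Real.sin θ))
    (fun θ _ => Real.abs_cos_le_one _)
  rw [sub_zero, abs_of_pos Real.pi_pos, one_mul, Real.norm_eq_abs] at h
  rw [abs_mul, abs_of_pos (by positivity)]
  calc _ ≤ 1 / Real.pi * Real.pi := by gcongr
    _ = 1 := by field_simp

theorem cos_odd_mul_pi_half_sub (j : ℕ) (t : ℝ) :
    Real.cos (t - (2 * (j : ℝ) + 1) * (Real.pi / 2)) = (-1) ^ j * Real.sin t := by
  rw [show t - (2 * (j : ℝ) + 1) * (Real.pi / 2) = (t - Real.pi / 2) - j * Real.pi by ring,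
    Real.cos_sub_nat_mul_pi, Real.cos_sub_pi_div_two]

theorem cos_odd_mul_pi_sub (j : ℕ) (t : ℝ) :
    Real.cos ((2 * (j : ℝ) + 1) * Real.pi - t) = -Real.cos t := by
  rw [← Real.cos_neg, show -((2 * (j : ℝ) + 1) * Real.pi - t) =
    t - ((2 * j + 1 : ℕ) : ℝ) * Real.pi by push_cast; ring, Real.cos_sub_nat_mul_pi, pow_succ,
    pow_mul]
  simp

theorem sin_odd_mul_pi_sub (j : ℕ) (t : ℝ) :
    Real.sin ((2 * (j : ℝ) + 1) * Real.pi - t) = Real.sin t := by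
  rw [← neg_neg (Real.sin _), ← Real.sin_neg, show -((2 * (j : ℝ) + 1) * Real.pi - t) =
    t - ((2 * j + 1 : ℕ) : ℝ) * Real.pi by push_cast; ring, Real.sin_sub_nat_mul_pi, pow_succ,
    pow_mul]
  simp

/-- The cosine form of Bessel's integral in odd order: the integrand has period `π`, and a shift by
`π / 2` exchanges `cos` and `sin`. -/
theorem integral_cos_mul_sin_mul_cos (j : ℕ) (x : ℝ) :
    ∫ θ in (0 : ℝ)..Real.pi, Real.cos ((2 * (j : ℝ) + 1) * θ) * Real.sin (x * Real.cos θ) =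
      (-1) ^ j * (Real.pi * besselJ (2 * j + 1) x) := by
  have hper : Function.Periodic
      (fun θ : ℝ => Real.cos ((2 * (j : ℝ) + 1) * θ) * Real.sin (x * Real.cos θ)) Real.pi := by
    intro θ
    have h1 : Real.cos ((2 * (j : ℝ) + 1) * (θ + Real.pi)) =
        -Real.cos ((2 * (j : ℝ) + 1) * θ) := by
      rw [← cos_odd_mul_pi_sub j, ← Real.cos_neg, ← Real.cos_add_nat_mul_two_pi _ (2 * j + 1)]
      congr 1
      push_cast
      ring
    simp only [h1, Real.cos_add_pi, mul_neg, Real.sin_neg, neg_mul, neg_neg]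
  rw [← integral_zero_pi_shift hper]
  have hz : ∫ θ in (0 : ℝ)..Real.pi,
      Real.cos ((2 * (j : ℝ) + 1) * θ) * Real.cos (x * Real.sin θ) = 0 := by
    refine integral_zero_pi_eq_zero_of_reflect fun θ => ?_
    rw [mul_sub, cos_odd_mul_pi_sub, Real.sin_pi_sub]
    ring
  have hJ : Real.pi * besselJ (2 * j + 1) x =
      ∫ θ in (0 : ℝ)..Real.pi, Real.sin ((2 * (j : ℝ) + 1) * θ) * Real.sin (x * Real.sin θ) := by
    unfold besselJ
    push_cast
    simp only [Real.cos_sub]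
    rw [intervalIntegral.integral_add ((by fun_prop : Continuous _).intervalIntegrable _ _)
      ((by fun_prop : Continuous _).intervalIntegrable _ _), hz]
    field_simp
    ring
  rw [hJ, ← intervalIntegral.integral_const_mul]
  refine intervalIntegral.integral_congr fun θ _ => ?_
  simp only [mul_sub, Real.cos_sub_pi_div_two, cos_odd_mul_pi_half_sub]
  ring

/-- One integration by parts, as `x sin θ cos (x cos θ)` is the derivative of `-sin (x cos θ)`. -/
theorem mul_integral_sin_mul_sin_mul_cos (j : ℕ) (x : ℝ) :
    x * ∫ θ in (0 : ℝ)..Real.pi,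
        Real.sin ((2 * (j : ℝ) + 1) * θ) * Real.sin θ * Real.cos (x * Real.cos θ) =
      (-1) ^ j * ((2 * j + 1) * Real.pi * besselJ (2 * j + 1) x) := by
  have hd : ∀ θ : ℝ, HasDerivAt
      (fun θ : ℝ => Real.sin ((2 * (j : ℝ) + 1) * θ) * Real.sin (x * Real.cos θ))
      ((2 * (j : ℝ) + 1) * (Real.cos ((2 * (j : ℝ) + 1) * θ) * Real.sin (x * Real.cos θ)) -
        x * (Real.sin ((2 * (j : ℝ) + 1) * θ) * Real.sin θ * Real.cos (x * Real.cos θ))) θ := by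
    intro θ
    refine ((((hasDerivAt_id θ).const_mul (2 * (j : ℝ) + 1)).sin).fun_mul
      (((Real.hasDerivAt_cos θ).const_mul x).sin)).congr_deriv ?_
    simp
    ring
  have hI := integral_eq_sub_of_hasDerivAt (a := 0) (b := Real.pi) (fun θ _ => hd θ)
    ((by fun_prop : Continuous _).intervalIntegrable _ _)
  have hs : Real.sin ((2 * (j : ℝ) + 1) * Real.pi) = 0 := by
    have := sin_odd_mul_pi_sub j 0
    simpa using this
  rw [intervalIntegral.integral_sub ((by fun_prop : Continuous _).intervalIntegrable _ _)
    ((by fun_prop : Continuous _).intervalIntegrable _ _), intervalIntegral.integral_const_mul,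
    intervalIntegral.integral_const_mul, integral_cos_mul_sin_mul_cos] at hI
  simp only [hs, mul_zero, Real.sin_zero, zero_mul, sub_zero] at hI
  linear_combination -hI

theorem besselJ_odd_zero (j : ℕ) : besselJ (2 * j + 1) 0 = 0 := by
  have := mul_integral_sin_mul_sin_mul_cos j 0
  rw [zero_mul] at this
  have h1 : ((-1 : ℝ) ^ j) ≠ 0 := by positivity
  have h2 : (2 * (j : ℝ) + 1) * Real.pi ≠ 0 := by positivity
  rcases mul_eq_zero.1 this.symm with h | h
  · exact absurd h h1
  · exact (mul_eq_zero.1 h).resolve_left h2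

theorem integral_sin_mul_sin_zero (j : ℕ) :
    ∫ θ in (0 : ℝ)..Real.pi, Real.sin ((2 * (j : ℝ) + 1) * θ) * Real.sin θ =
      if j = 0 then Real.pi / 2 else 0 := by
  split_ifs with h
  · subst h
    have := integral_sin_sq (a := 0) (b := Real.pi)
    simp only [Nat.cast_zero, mul_zero, zero_add, one_mul, ← sq]
    rw [this]
    simp
  · have hj : (j : ℝ) ≠ 0 := by exact_mod_cast h
    have hd : ∀ θ : ℝ, HasDerivAt
        (fun θ : ℝ => Real.sin (2 * j * θ) / (4 * j) - Real.sin ((2 * j + 2) * θ) / (4 * j + 4))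
        (Real.sin ((2 * (j : ℝ) + 1) * θ) * Real.sin θ) θ := by
      intro θ
      refine ((((hasDerivAt_id θ).const_mul (2 * (j : ℝ))).sin.div_const _).fun_sub
        (((hasDerivAt_id θ).const_mul (2 * (j : ℝ) + 2)).sin.div_const _)).congr_deriv ?_
      have h1 : 2 * (j : ℝ) * θ = (2 * (j : ℝ) + 1) * θ - θ := by ring
      have h2 : (2 * (j : ℝ) + 2) * θ = (2 * (j : ℝ) + 1) * θ + θ := by ring
      have h3 : (j : ℝ) + 1 ≠ 0 := by positivity
      have h4 : 4 * (j : ℝ) + 4 ≠ 0 := by positivity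
      simp only [id, h1, h2, Real.cos_add, Real.cos_sub]
      field_simp
      ring
    rw [integral_eq_sub_of_hasDerivAt (fun θ _ => hd θ)
      ((by fun_prop : Continuous _).intervalIntegrable _ _)]
    have h1 : Real.sin (2 * j * Real.pi) = 0 := by
      have := Real.sin_nat_mul_pi (2 * j); push_cast at this; exact this
    have h2 : Real.sin ((2 * j + 2) * Real.pi) = 0 := by
      have := Real.sin_nat_mul_pi (2 * j + 2); push_cast at this; exact this
    simp [h1, h2]

/-- The weight `1 + cos θ` packs `J₀` and `J₁` into one integral; it vanishes to second order at the
stationary point `θ = π`, which leaves only the stationary point `θ = 0`. -/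
theorem integral_cexp_mul_one_add_cos (x : ℝ) :
    ∫ θ in (0 : ℝ)..Real.pi, Complex.exp (Complex.I * (x * Real.cos θ : ℝ)) *
        (1 + Real.cos θ : ℝ) =
      Real.pi * (besselJ 0 x + Complex.I * besselJ 1 x) := by
  have hsplit : ∀ θ : ℝ, Complex.exp (Complex.I * (x * Real.cos θ : ℝ)) * (1 + Real.cos θ : ℝ) =
      ((Real.cos (x * Real.cos θ) + Real.cos θ * Real.cos (x * Real.cos θ) : ℝ) : ℂ) +
      Complex.I *
        ((Real.sin (x * Real.cos θ) + Real.cos θ * Real.sin (x * Real.cos θ) : ℝ) : ℂ) := by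
    intro θ
    rw [mul_comm Complex.I, Complex.exp_mul_I, ← Complex.ofReal_cos, ← Complex.ofReal_sin]
    push_cast
    ring
  simp only [hsplit]
  rw [intervalIntegral.integral_add ((by fun_prop : Continuous _).intervalIntegrable _ _)
    ((by fun_prop : Continuous _).intervalIntegrable _ _), intervalIntegral.integral_const_mul,
    intervalIntegral.integral_ofReal, intervalIntegral.integral_ofReal,
    intervalIntegral.integral_add ((by fun_prop : Continuous _).intervalIntegrable _ _)
    ((by fun_prop : Continuous _).intervalIntegrable _ _),
    intervalIntegral.integral_add ((by fun_prop : Continuous _).intervalIntegrable _ _)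
    ((by fun_prop : Continuous _).intervalIntegrable _ _)]
  have h1 : ∫ θ in (0 : ℝ)..Real.pi, Real.cos θ * Real.cos (x * Real.cos θ) = 0 :=
    integral_zero_pi_eq_zero_of_reflect fun θ => by
      simp [Real.cos_pi_sub]
  have h2 : ∫ θ in (0 : ℝ)..Real.pi, Real.sin (x * Real.cos θ) = 0 :=
    integral_zero_pi_eq_zero_of_reflect fun θ => by
      simp [Real.cos_pi_sub]
  have h3 : ∫ θ in (0 : ℝ)..Real.pi, Real.cos θ * Real.sin (x * Real.cos θ) =
      Real.pi * besselJ 1 x := by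
    have := integral_cos_mul_sin_mul_cos 0 x
    simpa using this
  have h4 : ∫ θ in (0 : ℝ)..Real.pi, Real.cos (x * Real.cos θ) = Real.pi * besselJ 0 x := by
    rw [← integral_zero_pi_shift (fun θ => by simp [Real.cos_add_pi])]
    unfold besselJ
    simp only [Real.cos_sub_pi_div_two, Int.cast_zero, zero_mul, zero_sub, Real.cos_neg]
    field_simp
  rw [h1, h2, h3, h4]
  push_cast
  ring

end BesselIntegral

/-! ### Asymptotics of Bessel functions -/

section BesselAsymptotics

open MeasureTheory Set Topology intervalIntegral

/-- In the coordinate `v = 2 sin (θ / 2)` the phase `x cos θ` becomes exactly quadratic. -/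
theorem hasDerivAt_fresnel_comp (x θ : ℝ) :
    HasDerivAt (fun θ : ℝ => Complex.exp (Complex.I * x) *
        ∫ v in (0 : ℝ)..2 * Real.sin (θ / 2), Complex.exp (-(Complex.I * x) * (v : ℂ) ^ 2 / 2))
      (Complex.exp (Complex.I * (x * Real.cos θ : ℝ)) * (Real.cos (θ / 2) : ℝ)) θ := by
  have hc : Continuous fun v : ℝ => Complex.exp (-(Complex.I * x) * (v : ℂ) ^ 2 / 2) := by fun_prop
  have h1 : HasDerivAt (fun θ : ℝ => 2 * Real.sin (θ / 2)) (Real.cos (θ / 2)) θ := by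
    refine ((((hasDerivAt_id θ).div_const 2).sin).const_mul 2).congr_deriv ?_
    simp
    ring
  have h2 := (hc.integral_hasStrictDerivAt 0 (2 * Real.sin (θ / 2))).hasDerivAt
  refine ((h2.scomp θ h1).const_mul (Complex.exp (Complex.I * x))).congr_deriv ?_
  rw [Complex.real_smul, mul_left_comm, ← Complex.exp_add, mul_comm]
  congr 2
  have : Real.cos θ = 1 - 2 * Real.sin (θ / 2) ^ 2 := by
    rw [Real.sin_sq_eq_half_sub, mul_div_cancel₀ _ two_ne_zero]
    ring
  rw [this]
  push_cast
  ring

/-- Van der Corput's bound for the phase `x cos θ`, when the amplitude vanishes at the stationary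
point `π`: the primitive of the oscillating factor is a truncated Fresnel integral. -/
theorem exists_norm_integral_cexp_cos_half_le (A A' : ℝ → ℝ)
    (hA : ∀ θ ∈ Icc 0 Real.pi, HasDerivAt A (A' θ) θ) (hA' : ContinuousOn A' (Icc 0 Real.pi)) :
    ∃ C : ℝ, ∀ x : ℝ, 0 < x →
      ‖∫ θ in (0 : ℝ)..Real.pi, Complex.exp (Complex.I * (x * Real.cos θ : ℝ)) *
        (Real.cos (θ / 2) * A θ : ℝ)‖ ≤ C / √x := by
  obtain ⟨M, hM⟩ := isCompact_Icc.exists_bound_of_continuousOn hA'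
  refine ⟨3 * |A Real.pi| + 3 * M * Real.pi, fun x hx => ?_⟩
  have hu : uIcc (0 : ℝ) Real.pi = Icc 0 Real.pi := uIcc_of_le Real.pi_pos.le
  set Φ : ℝ → ℂ := fun θ => Complex.exp (Complex.I * x) *
    ∫ v in (0 : ℝ)..2 * Real.sin (θ / 2), Complex.exp (-(Complex.I * x) * (v : ℂ) ^ 2 / 2) with hΦ
  have hΦb : ∀ θ ∈ Icc 0 Real.pi, ‖Φ θ‖ ≤ 3 / √x := by
    intro θ hθ
    have h0 : 0 ≤ 2 * Real.sin (θ / 2) :=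
      mul_nonneg two_pos.le (Real.sin_nonneg_of_nonneg_of_le_pi (by linarith [hθ.1])
        (by linarith [hθ.2, Real.pi_pos]))
    rw [hΦ, norm_mul, mul_comm Complex.I, Complex.norm_exp_ofReal_mul_I, one_mul,
      mul_comm _ Complex.I]
    exact norm_fresnel_le hx h0
  have hparts := intervalIntegral.integral_mul_deriv_eq_deriv_mul (a := 0) (b := Real.pi)
    (u := fun θ : ℝ => (A θ : ℂ)) (u' := fun θ : ℝ => (A' θ : ℂ)) (v := Φ)
    (v' := fun θ : ℝ => Complex.exp (Complex.I * (x * Real.cos θ : ℝ)) * (Real.cos (θ / 2) : ℝ))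
    (fun θ hθ => (hA θ (hu ▸ hθ)).ofReal_comp) (fun θ _ => hasDerivAt_fresnel_comp x θ)
    ((Complex.continuous_ofReal.comp_continuousOn (hu ▸ hA')).intervalIntegrable)
    ((by fun_prop : Continuous _).intervalIntegrable _ _)
  have heq : ∫ θ in (0 : ℝ)..Real.pi, Complex.exp (Complex.I * (x * Real.cos θ : ℝ)) *
        (Real.cos (θ / 2) * A θ : ℝ) = ∫ θ in (0 : ℝ)..Real.pi, (A θ : ℂ) *
          (Complex.exp (Complex.I * (x * Real.cos θ : ℝ)) * (Real.cos (θ / 2) : ℝ)) := by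
    refine intervalIntegral.integral_congr fun θ _ => ?_
    push_cast
    ring
  have hΦ0 : Φ 0 = 0 := by simp [hΦ]
  rw [heq, hparts, hΦ0, mul_zero, sub_zero]
  have h1 : ‖(A Real.pi : ℂ) * Φ Real.pi‖ ≤ |A Real.pi| * (3 / √x) := by
    rw [norm_mul, Complex.norm_real, Real.norm_eq_abs]
    gcongr
    exact hΦb _ ⟨Real.pi_pos.le, le_rfl⟩
  have h2 : ‖∫ θ in (0 : ℝ)..Real.pi, (A' θ : ℂ) * Φ θ‖ ≤ M * (3 / √x) * |Real.pi - 0| := by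
    refine norm_integral_le_of_norm_le_const fun θ hθ => ?_
    rw [uIoc_of_le Real.pi_pos.le] at hθ
    have hθ' : θ ∈ Icc 0 Real.pi := ⟨hθ.1.le, hθ.2⟩
    rw [norm_mul, Complex.norm_real]
    exact mul_le_mul (hM θ hθ') (hΦb θ hθ') (norm_nonneg _) ((norm_nonneg _).trans (hM θ hθ'))
  rw [sub_zero, abs_of_pos Real.pi_pos] at h2
  calc _ ≤ |A Real.pi| * (3 / √x) + M * (3 / √x) * Real.pi :=
        (norm_sub_le _ _).trans (add_le_add h1 h2)
    _ = (3 * |A Real.pi| + 3 * M * Real.pi) / √x := by ring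

theorem one_add_cos_half_pos {θ : ℝ} (hθ : θ ∈ Icc 0 Real.pi) : 0 < 1 + Real.cos (θ / 2) := by
  have := Real.cos_nonneg_of_mem_Icc (x := θ / 2)
    ⟨by linarith [hθ.1, Real.pi_pos], by linarith [hθ.2]⟩
  linarith

/-- Van der Corput's bound for the amplitude `1 / (2 (1 + cos (θ / 2)))`, the derivative of
`tan (θ / 4)`. -/
theorem exists_norm_integral_cexp_inv_one_add_cos_half_le :
    ∃ C : ℝ, ∀ x : ℝ, 0 < x →
      ‖∫ θ in (0 : ℝ)..Real.pi, Complex.exp (Complex.I * (x * Real.cos θ : ℝ)) *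
        (1 / (2 * (1 + Real.cos (θ / 2))) : ℝ)‖ ≤ C / √x := by
  have hcosd : ∀ θ : ℝ, HasDerivAt (fun θ : ℝ => Real.cos (θ / 2)) (-Real.sin (θ / 2) / 2) θ := by
    intro θ
    refine (((hasDerivAt_id θ).div_const 2).cos).congr_deriv ?_
    simp
    ring
  -- With `c = cos (θ / 2)` and `s = sin (θ / 2)` the amplitude is
  -- `c (c / 2 - 1 / (2 (1 + c))) + s (s / 2)`; each summand vanishes at one stationary point.
  obtain ⟨C₁, h₁⟩ := exists_norm_integral_cexp_cos_half_le
    (fun θ => Real.cos (θ / 2) / 2 - 1 / (2 * (1 + Real.cos (θ / 2))))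
    (fun θ => -Real.sin (θ / 2) / 4 - Real.sin (θ / 2) / (4 * (1 + Real.cos (θ / 2)) ^ 2))
    (fun θ hθ => by
      have h0 := one_add_cos_half_pos hθ
      refine (((hcosd θ).div_const 2).fun_sub ((hasDerivAt_const θ (1 : ℝ)).fun_div
        (((hcosd θ).const_add 1).const_mul 2) (by positivity))).congr_deriv ?_
      field_simp
      ring)
    (fun θ hθ => by
      have h0 := one_add_cos_half_pos hθ
      refine ContinuousAt.continuousWithinAt (ContinuousAt.sub (by fun_prop)
        (ContinuousAt.div (by fun_prop) (by fun_prop) (by positivity))))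
  obtain ⟨C₂, h₂⟩ := exists_norm_integral_cexp_cos_half_le
    (fun θ => Real.cos (θ / 2) / 2) (fun θ => -Real.sin (θ / 2) / 4)
    (fun θ hθ => ((hcosd θ).div_const 2).congr_deriv (by ring)) (by fun_prop)
  refine ⟨C₁ + C₂, fun x hx => ?_⟩
  -- The reflection `θ ↦ π - θ` exchanges the stationary points and conjugates the exponential.
  have hreflect : ‖∫ θ in (0 : ℝ)..Real.pi, Complex.exp (Complex.I * (x * Real.cos θ : ℝ)) *
        (Real.sin (θ / 2) * (Real.sin (θ / 2) / 2) : ℝ)‖ ≤ C₂ / √x := by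
    refine le_trans (le_of_eq ?_) (h₂ x hx)
    rw [← Complex.norm_conj, ← intervalIntegral_conj]
    have h := intervalIntegral.integral_comp_sub_left (a := 0) (b := Real.pi)
      (fun θ : ℝ => (starRingEnd ℂ) (Complex.exp (Complex.I * (x * Real.cos θ : ℝ)) *
        (Real.sin (θ / 2) * (Real.sin (θ / 2) / 2) : ℝ))) Real.pi
    rw [sub_self, sub_zero] at h
    rw [← h]
    congr 1
    refine intervalIntegral.integral_congr fun θ _ => ?_
    simp only [map_mul, Complex.conj_ofReal, ← Complex.exp_conj, Complex.conj_I, Real.cos_pi_sub,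
      sub_div, Real.sin_pi_div_two_sub]
    congr 2
    push_cast
    ring
  have hI₁ : IntervalIntegrable (fun θ : ℝ => Complex.exp (Complex.I * (x * Real.cos θ : ℝ)) *
      (Real.cos (θ / 2) * (Real.cos (θ / 2) / 2 - 1 / (2 * (1 + Real.cos (θ / 2)))) : ℝ))
      volume 0 Real.pi := by
    refine ContinuousOn.intervalIntegrable fun θ hθ => ?_
    rw [uIcc_of_le Real.pi_pos.le] at hθ
    have h0 := one_add_cos_half_pos hθ
    have : ContinuousAt (fun θ : ℝ => 1 / (2 * (1 + Real.cos (θ / 2)))) θ :=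
      ContinuousAt.div (by fun_prop) (by fun_prop) (by positivity)
    refine ContinuousAt.continuousWithinAt (ContinuousAt.mul (by fun_prop)
      (Complex.continuous_ofReal.continuousAt.comp ?_))
    exact ContinuousAt.mul (by fun_prop) (ContinuousAt.sub (by fun_prop) this)
  have heq : ∫ θ in (0 : ℝ)..Real.pi, Complex.exp (Complex.I * (x * Real.cos θ : ℝ)) *
        (1 / (2 * (1 + Real.cos (θ / 2))) : ℝ) =
      (∫ θ in (0 : ℝ)..Real.pi, Complex.exp (Complex.I * (x * Real.cos θ : ℝ)) *
      (Real.cos (θ / 2) * (Real.cos (θ / 2) / 2 - 1 / (2 * (1 + Real.cos (θ / 2)))) : ℝ)) +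
      ∫ θ in (0 : ℝ)..Real.pi, Complex.exp (Complex.I * (x * Real.cos θ : ℝ)) *
        (Real.sin (θ / 2) * (Real.sin (θ / 2) / 2) : ℝ) := by
    rw [← intervalIntegral.integral_add hI₁ ((by fun_prop : Continuous _).intervalIntegrable _ _)]
    refine intervalIntegral.integral_congr fun θ hθ => ?_
    rw [uIcc_of_le Real.pi_pos.le] at hθ
    have h0 := one_add_cos_half_pos hθ
    rw [← mul_add, ← Complex.ofReal_add]
    congr 2
    have hsq := Real.sin_sq_add_cos_sq (θ / 2)
    field_simp
    linear_combination (-1 - Real.cos (θ / 2)) * hsq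
  rw [heq, add_div]
  exact (norm_add_le _ _).trans (add_le_add (h₁ x hx) hreflect)

/-- `J₀ + i J₁` is asymptotic to `√(2 / (π x)) e^{i (x - π / 4)}`, with error `O(x ^ (-3/2))`. -/
theorem exists_norm_besselJ_zero_add_I_mul_one_sub_le :
    ∃ C : ℝ, ∀ x : ℝ, 1 ≤ x →
      ‖(besselJ 0 x + Complex.I * besselJ 1 x : ℂ) -
        (√(2 / (Real.pi * x)) : ℝ) * Complex.exp (Complex.I * (x - Real.pi / 4 : ℝ))‖ ≤
        C / (x * √x) := by
  obtain ⟨C, hC⟩ := exists_norm_integral_cexp_inv_one_add_cos_half_le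
  refine ⟨(1 / 2 + C) / Real.pi, fun x hx => ?_⟩
  have hx0 : 0 < x := one_pos.trans_le hx
  have hxC : (x : ℂ) ≠ 0 := by exact_mod_cast hx0.ne'
  have hπC : (Real.pi : ℂ) ≠ 0 := by exact_mod_cast Real.pi_ne_zero
  set E : ℝ → ℂ := fun θ => Complex.exp (Complex.I * (x * Real.cos θ : ℝ)) with hE
  set P : ℂ := ∫ v in (0 : ℝ)..2, Complex.exp (-(Complex.I * x) * (v : ℂ) ^ 2 / 2) with hP
  set K : ℂ := ∫ θ in (0 : ℝ)..Real.pi, E θ * (1 / (2 * (1 + Real.cos (θ / 2))) : ℝ) with hK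
  have hEc : Continuous E := by fun_prop
  have hEd : ∀ θ : ℝ, HasDerivAt E (E θ * (-(Complex.I * x) * Real.sin θ)) θ := by
    intro θ
    refine (((((Real.hasDerivAt_cos θ).const_mul x).ofReal_comp).const_mul Complex.I).cexp
      ).congr_deriv ?_
    simp only [hE]
    push_cast
    ring
  have hfirst : ∫ θ in (0 : ℝ)..Real.pi, E θ * (Real.cos (θ / 2) : ℝ) =
      Complex.exp (Complex.I * x) * P := by
    rw [integral_eq_sub_of_hasDerivAt (fun θ _ => hasDerivAt_fresnel_comp x θ)
      ((by fun_prop : Continuous _).intervalIntegrable _ _)]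
    simp [hP]
  have htd : ∀ θ ∈ Icc 0 Real.pi, HasDerivAt
      (fun θ : ℝ => Real.sin (θ / 2) / (1 + Real.cos (θ / 2)))
      (1 / (2 * (1 + Real.cos (θ / 2)))) θ := by
    intro θ hθ
    have h0 := one_add_cos_half_pos hθ
    refine ((((hasDerivAt_id θ).div_const 2).sin).fun_div
      ((((hasDerivAt_id θ).div_const 2).cos).const_add 1) h0.ne').congr_deriv ?_
    have hsq := Real.sin_sq_add_cos_sq (θ / 2)
    simp only [id]
    field_simp
    linear_combination hsq
  have hu : uIcc (0 : ℝ) Real.pi = Icc 0 Real.pi := uIcc_of_le Real.pi_pos.le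
  have hsecond : ∫ θ in (0 : ℝ)..Real.pi,
      ((Real.sin (θ / 2) / (1 + Real.cos (θ / 2)) : ℝ) : ℂ) *
        (E θ * (-(Complex.I * x) * Real.sin θ)) = Complex.exp (-(Complex.I * x)) - K := by
    rw [intervalIntegral.integral_mul_deriv_eq_deriv_mul
      (fun θ hθ => (htd θ (hu ▸ hθ)).ofReal_comp) (fun θ _ => hEd θ) ?_
      ((by fun_prop : Continuous _).intervalIntegrable _ _)]
    · have hEpi : E Real.pi = Complex.exp (-(Complex.I * x)) := by simp [hE]
      have hKeq : ∫ θ in (0 : ℝ)..Real.pi, ((1 / (2 * (1 + Real.cos (θ / 2))) : ℝ) : ℂ) * E θ = K :=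
        intervalIntegral.integral_congr fun θ _ => mul_comm _ _
      rw [hKeq, hEpi]
      simp
    · refine (Complex.continuous_ofReal.comp_continuousOn fun θ hθ => ?_).intervalIntegrable
      have h0 := one_add_cos_half_pos (hu ▸ hθ)
      exact ContinuousAt.continuousWithinAt
        (ContinuousAt.div (by fun_prop) (by fun_prop) (by positivity))
  -- `1 + cos θ = 2 cos (θ / 2) - tan (θ / 4) sin θ`, where `tan (θ / 4)` is written as
  -- `sin (θ / 2) / (1 + cos (θ / 2))`.
  have hG : Real.pi * (besselJ 0 x + Complex.I * besselJ 1 x) =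
      2 * (Complex.exp (Complex.I * x) * P) +
        1 / (Complex.I * x) * (Complex.exp (-(Complex.I * x)) - K) := by
    rw [← integral_cexp_mul_one_add_cos, ← hfirst, ← hsecond,
      ← intervalIntegral.integral_const_mul, ← intervalIntegral.integral_const_mul,
      ← intervalIntegral.integral_add ((by fun_prop : Continuous _).intervalIntegrable _ _)]
    · refine intervalIntegral.integral_congr fun θ hθ => ?_
      have h0 := one_add_cos_half_pos (hu ▸ hθ)
      have hsq := Real.sin_sq_add_cos_sq (θ / 2)
      have hs : Real.sin θ = 2 * Real.sin (θ / 2) * Real.cos (θ / 2) := by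
        rw [← Real.sin_two_mul]; congr 1; ring
      have hc : Real.cos θ = 2 * Real.cos (θ / 2) ^ 2 - 1 := by
        rw [← Real.cos_two_mul]; congr 1; ring
      have hreal : 1 + Real.cos θ = 2 * Real.cos (θ / 2) -
          Real.sin (θ / 2) / (1 + Real.cos (θ / 2)) * Real.sin θ := by
        rw [hs, hc]
        field_simp
        linear_combination (2 * Real.cos (θ / 2)) * hsq
      change E θ * _ = _
      rw [hreal]
      push_cast
      field_simp
      ring
    · refine ContinuousOn.intervalIntegrable fun θ hθ => ?_
      have h0 := one_add_cos_half_pos (hu ▸ hθ)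
      have : ContinuousAt (fun θ : ℝ => Real.sin (θ / 2) / (1 + Real.cos (θ / 2))) θ :=
        ContinuousAt.div (by fun_prop) (by fun_prop) (by positivity)
      refine ContinuousAt.continuousWithinAt (ContinuousAt.mul continuousAt_const
        (ContinuousAt.mul (Complex.continuous_ofReal.continuousAt.comp this) (by fun_prop)))
  have hF := norm_fresnel_two_sub_le hx0
  rw [← hP] at hF
  have hKb := hC x hx0
  rw [← hK] at hKb
  have hsqrt : √(2 / (Real.pi * x)) * Real.pi = √(2 * Real.pi / x) := by
    rw [← Real.sqrt_sq Real.pi_pos.le, ← Real.sqrt_mul (by positivity),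
      Real.sqrt_sq Real.pi_pos.le]
    congr 1
    field_simp
  have hexp1 : Complex.exp (Complex.I * x) * Complex.exp (-2 * (Complex.I * x)) =
      Complex.exp (-(Complex.I * x)) := by
    rw [← Complex.exp_add]; congr 1; ring
  have hexp2 : Complex.exp (Complex.I * (x - Real.pi / 4 : ℝ)) =
      Complex.exp (Complex.I * x) * Complex.exp (-(Complex.I * (Real.pi / 4))) := by
    rw [← Complex.exp_add]; congr 1; push_cast; ring
  -- The boundary term `e^{-ix} / (ix)` of the integration by parts cancels the one of the Fresnel
  -- integral, so that no term of order `1 / x` survives.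
  have hmain : Real.pi * ((besselJ 0 x + Complex.I * besselJ 1 x : ℂ) -
        (√(2 / (Real.pi * x)) : ℝ) * Complex.exp (Complex.I * (x - Real.pi / 4 : ℝ))) =
      -2 * (Complex.exp (Complex.I * x) * ((√(2 * Real.pi / x) : ℝ) *
        Complex.exp (-(Complex.I * (Real.pi / 4))) / 2 - P -
        Complex.exp (-2 * (Complex.I * x)) / (2 * (Complex.I * x)))) -
        1 / (Complex.I * x) * K := by
    rw [mul_sub, hG, hexp2, ← hsqrt, ← hexp1]
    push_cast
    field_simp
    ring
  have hb : ‖(Real.pi : ℂ) * ((besselJ 0 x + Complex.I * besselJ 1 x : ℂ) -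
        (√(2 / (Real.pi * x)) : ℝ) * Complex.exp (Complex.I * (x - Real.pi / 4 : ℝ)))‖ ≤
      2 * (1 / (4 * x ^ 2)) + 1 / x * (C / √x) := by
    rw [hmain]
    refine (norm_sub_le _ _).trans (add_le_add ?_ ?_)
    · rw [norm_mul, norm_mul, mul_comm Complex.I (x : ℂ), Complex.norm_exp_ofReal_mul_I, one_mul,
        mul_comm (x : ℂ) Complex.I]
      have : ‖(-2 : ℂ)‖ = 2 := by simp
      rw [this]
      gcongr
    · rw [norm_mul, norm_div, norm_mul, Complex.norm_I, Complex.norm_real,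
        Real.norm_of_nonneg hx0.le, norm_one, one_mul]
      gcongr
  rw [norm_mul, Complex.norm_real, Real.norm_of_nonneg Real.pi_pos.le] at hb
  have hsx : √x ≤ x := by
    rw [Real.sqrt_le_left hx0.le]
    nlinarith
  have hsx0 : 0 < √x := Real.sqrt_pos.2 hx0
  have h3 : 2 * (1 / (4 * x ^ 2)) ≤ 1 / 2 / (x * √x) := by
    rw [show 2 * (1 / (4 * x ^ 2)) = 1 / 2 / (x * x) by field_simp; norm_num]
    gcongr
  rw [div_right_comm (1 / 2 + C), le_div_iff₀ Real.pi_pos, mul_comm]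
  calc _ ≤ 1 / 2 / (x * √x) + 1 / x * (C / √x) := hb.trans (by gcongr)
    _ = (1 / 2 + C) / (x * √x) := by field_simp

theorem sqrt_two_div_pi_mul_le {x : ℝ} (hx : 0 < x) : √(2 / (Real.pi * x)) ≤ 1 / √x := by
  rw [← Real.sqrt_one, ← Real.sqrt_div zero_le_one]
  apply Real.sqrt_le_sqrt
  rw [div_le_div_iff₀ (by positivity) hx]
  nlinarith [Real.pi_gt_three]

theorem abs_sqrt_mul_cos_le {x : ℝ} (hx : 0 < x) (t : ℝ) :
    |√(2 / (Real.pi * x)) * Real.cos t| ≤ 1 / √x := by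
  rw [abs_mul, abs_of_nonneg (Real.sqrt_nonneg _)]
  calc _ ≤ 1 / √x * 1 := mul_le_mul (sqrt_two_div_pi_mul_le hx) (Real.abs_cos_le_one t)
        (abs_nonneg _) (by positivity)
    _ = _ := mul_one _

theorem abs_le_of_abs_sub_sqrt_mul_cos_le {x a t C : ℝ} (hx : 1 ≤ x)
    (h : |a - √(2 / (Real.pi * x)) * Real.cos t| ≤ C / (x * √x)) : |a| ≤ (C + 1) / √x := by
  have hx0 : 0 < x := one_pos.trans_le hx
  have hsx : 0 < √x := Real.sqrt_pos.2 hx0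
  have hC : 0 ≤ C := by
    have h1 : 0 ≤ C / (x * √x) := (abs_nonneg _).trans h
    by_contra hneg
    exact absurd h1 (not_le.2 (div_neg_of_neg_of_pos (not_le.1 hneg) (by positivity)))
  have h2 : C / (x * √x) ≤ C / √x := by
    gcongr
    nlinarith
  calc |a| = |(a - √(2 / (Real.pi * x)) * Real.cos t) + √(2 / (Real.pi * x)) * Real.cos t| := by
        rw [sub_add_cancel]
    _ ≤ C / √x + 1 / √x :=
      (abs_add_le _ _).trans (add_le_add (h.trans h2) (abs_sqrt_mul_cos_le hx0 t))
    _ = _ := by ring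

/-- The leading asymptotics of `J_n` with error `O(x ^ (-3/2))`. The three-term recurrence carries
the estimate from the orders `0` and `1` to all orders. -/
theorem exists_abs_besselJ_sub_le (n : ℕ) :
    ∃ C : ℝ, ∀ x : ℝ, 1 ≤ x →
      |besselJ n x - √(2 / (Real.pi * x)) * Real.cos (x - n * (Real.pi / 2) - Real.pi / 4)| ≤
        C / (x * √x) := by
  induction n using Nat.twoStepInduction with
  | zero =>
    obtain ⟨C, hC⟩ := exists_norm_besselJ_zero_add_I_mul_one_sub_le
    refine ⟨C, fun x hx => le_trans (le_of_eq ?_) ((Complex.abs_re_le_norm _).trans (hC x hx))⟩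
    rw [mul_comm Complex.I ((x - Real.pi / 4 : ℝ) : ℂ), Complex.sub_re, Complex.re_ofReal_mul,
      Complex.exp_ofReal_mul_I_re]
    simp
  | one =>
    obtain ⟨C, hC⟩ := exists_norm_besselJ_zero_add_I_mul_one_sub_le
    refine ⟨C, fun x hx => le_trans (le_of_eq ?_) ((Complex.abs_im_le_norm _).trans (hC x hx))⟩
    rw [mul_comm Complex.I ((x - Real.pi / 4 : ℝ) : ℂ), Complex.sub_im, Complex.im_ofReal_mul,
      Complex.exp_ofReal_mul_I_im, Nat.cast_one, Nat.cast_one, one_mul, sub_right_comm,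
      Real.cos_sub_pi_div_two]
    simp
  | more n ih₀ ih₁ =>
    obtain ⟨C₀, h₀⟩ := ih₀
    obtain ⟨C₁, h₁⟩ := ih₁
    refine ⟨2 * (n + 1) * (C₁ + 1) + C₀, fun x hx => ?_⟩
    have hx0 : 0 < x := one_pos.trans_le hx
    have hsx : 0 < √x := Real.sqrt_pos.2 hx0
    have hJ₁ := abs_le_of_abs_sub_sqrt_mul_cos_le hx (h₁ x hx)
    have hrec := besselJ_recurrence n x
    have hcos : Real.cos (x - ((n + 2 : ℕ) : ℝ) * (Real.pi / 2) - Real.pi / 4) =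
        -Real.cos (x - n * (Real.pi / 2) - Real.pi / 4) := by
      rw [← Real.cos_sub_pi]
      congr 1
      push_cast
      ring
    -- The main terms of orders `n` and `n + 2` are opposite.
    have hdiff : besselJ ((n + 2 : ℕ) : ℤ) x - √(2 / (Real.pi * x)) *
        Real.cos (x - ((n + 2 : ℕ) : ℝ) * (Real.pi / 2) - Real.pi / 4) =
        2 * ((n : ℝ) + 1) / x * besselJ ((n + 1 : ℕ) : ℤ) x -
          (besselJ n x - √(2 / (Real.pi * x)) *
            Real.cos (x - n * (Real.pi / 2) - Real.pi / 4)) := by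
      rw [hcos]
      push_cast at hrec ⊢
      field_simp
      linear_combination hrec
    rw [hdiff]
    calc _ ≤ 2 * ((n : ℝ) + 1) / x * ((C₁ + 1) / √x) + C₀ / (x * √x) := by
          refine (abs_sub _ _).trans (add_le_add ?_ (h₀ x hx))
          rw [abs_mul, abs_of_nonneg (by positivity)]
          gcongr
      _ = _ := by field_simp

theorem cos_sub_odd_mul_pi_half_sub (j : ℕ) (x : ℝ) :
    Real.cos (x - ((2 * j + 1 : ℕ) : ℝ) * (Real.pi / 2) - Real.pi / 4) =
      (-1) ^ j * Real.cos (x - 3 * Real.pi / 4) := by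
  rw [← Real.cos_sub_nat_mul_pi]
  congr 1
  push_cast
  ring

/-- A form of the asymptotics of `J_{2j+1}` valid on all of `(0, ∞)`: the error is of order
`x ^ (-1/2)` near `0` and `x ^ (-3/2)` near `∞`. -/
theorem exists_abs_besselJ_odd_sub_le (j : ℕ) :
    ∃ C : ℝ, 0 ≤ C ∧ ∀ x : ℝ, 0 < x →
      |besselJ (2 * j + 1) x - (-1) ^ j * (√(2 / (Real.pi * x)) *
        Real.cos (x - 3 * Real.pi / 4))| ≤ C / (√x * (1 + √x) ^ 2) := by
  obtain ⟨C, hC⟩ := exists_abs_besselJ_sub_le (2 * j + 1)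
  refine ⟨max 8 (4 * C), le_max_of_le_left (by norm_num), fun x hx => ?_⟩
  have hsx : 0 < √x := Real.sqrt_pos.2 hx
  have hsq : √x ^ 2 = x := Real.sq_sqrt hx.le
  rcases le_total 1 x with h | h
  · have h1 := hC x h
    rw [cos_sub_odd_mul_pi_half_sub] at h1
    push_cast at h1
    rw [mul_left_comm]
    have hC0 : 0 ≤ C := by
      by_contra hneg
      exact absurd ((abs_nonneg _).trans h1)
        (not_le.2 (div_neg_of_neg_of_pos (not_le.1 hneg) (by positivity)))
    have hs1 : 1 ≤ √x := Real.one_le_sqrt.2 h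
    calc _ ≤ C / (x * √x) := h1
      _ = 4 * C / (√x * (4 * x)) := by field_simp
      _ ≤ 4 * C / (√x * (1 + √x) ^ 2) := by
          gcongr
          nlinarith
      _ ≤ _ := by
          gcongr
          exact le_max_right _ _
  · have hs1 : √x ≤ 1 := Real.sqrt_le_one.2 h
    have h2 : |(-1 : ℝ) ^ j * (√(2 / (Real.pi * x)) * Real.cos (x - 3 * Real.pi / 4))| ≤
        1 / √x := by
      rw [abs_mul, abs_pow, abs_neg, abs_one, one_pow, one_mul]
      exact abs_sqrt_mul_cos_le hx _
    calc _ ≤ 1 + 1 / √x := (abs_sub _ _).trans (add_le_add (abs_besselJ_le_one _ _) h2)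
      _ ≤ 1 / √x + 1 / √x := by
          gcongr
          rw [le_div_iff₀ hsx]
          linarith
      _ = 8 / (√x * 4) := by field_simp; norm_num
      _ ≤ 8 / (√x * (1 + √x) ^ 2) := by
          gcongr
          nlinarith
      _ ≤ _ := by
          gcongr
          exact le_max_left _ _

theorem exists_abs_besselJ_odd_le (j : ℕ) :
    ∃ C : ℝ, 0 ≤ C ∧ ∀ x : ℝ, 0 < x → |besselJ (2 * j + 1) x| ≤ C / √x := by
  obtain ⟨C, hC0, hC⟩ := exists_abs_besselJ_odd_sub_le j
  refine ⟨C + 1, by positivity, fun x hx => ?_⟩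
  have hsx : 0 < √x := Real.sqrt_pos.2 hx
  have h2 : |(-1 : ℝ) ^ j * (√(2 / (Real.pi * x)) * Real.cos (x - 3 * Real.pi / 4))| ≤
      1 / √x := by
    rw [abs_mul, abs_pow, abs_neg, abs_one, one_pow, one_mul]
    exact abs_sqrt_mul_cos_le hx _
  have h3 : C / (√x * (1 + √x) ^ 2) ≤ C / √x := by
    gcongr
    exact le_mul_of_one_le_right hsx.le (by nlinarith)
  rw [add_div, ← sub_add_cancel (besselJ (2 * j + 1) x)
    ((-1 : ℝ) ^ j * (√(2 / (Real.pi * x)) * Real.cos (x - 3 * Real.pi / 4)))]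
  exact (abs_add_le _ _).trans (add_le_add ((hC x hx).trans h3) h2)

end BesselAsymptotics

/-! ### Poisson summation -/

section Poisson

open MeasureTheory Set Topology FourierTransform

/-- The summand of the murmuration density in weight `2j + 2`, with `R = 2 √y`, as a function of a
real variable. It vanishes outside `(-R, R)` because `√` is `0` on negative numbers. -/
noncomputable def wave (j : ℕ) (R x : ℝ) : ℝ :=
  √(R ^ 2 - x ^ 2) * (Polynomial.Chebyshev.U ℝ ((2 * j : ℕ) : ℤ)).eval (x / R)

/-- The Fourier transform of `wave j R`, in the coordinate `x = R cos θ`. -/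
noncomputable def waveFourier (j : ℕ) (R t : ℝ) : ℝ :=
  R ^ 2 * ∫ θ in (0 : ℝ)..Real.pi,
    Real.sin ((2 * (j : ℝ) + 1) * θ) * Real.sin θ * Real.cos (2 * Real.pi * R * t * Real.cos θ)

theorem continuous_wave (j : ℕ) (R : ℝ) : Continuous (wave j R) := by
  unfold wave
  fun_prop

theorem wave_neg (j : ℕ) (R x : ℝ) : wave j R (-x) = wave j R x := by
  unfold wave
  rw [neg_sq, neg_div, Polynomial.Chebyshev.U_eval_neg]
  simp

theorem wave_eq_zero {j : ℕ} {R x : ℝ} (hR : 0 ≤ R) (hx : R ≤ |x|) : wave j R x = 0 := by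
  unfold wave
  have : R ^ 2 ≤ x ^ 2 := by
    rw [← sq_abs x]
    gcongr
  rw [Real.sqrt_eq_zero_of_nonpos (by linarith), zero_mul]

theorem wave_mul {d : ℝ} (hd : 0 < d) (j : ℕ) (R x : ℝ) :
    wave j R (d * x) = d * wave j (R / d) x := by
  unfold wave
  have h1 : R ^ 2 - (d * x) ^ 2 = d ^ 2 * ((R / d) ^ 2 - x ^ 2) := by
    field_simp
  have h2 : d * x / R = x / (R / d) := by
    rw [div_div_eq_mul_div, mul_comm]
  rw [h1, h2, Real.sqrt_mul (sq_nonneg d), Real.sqrt_sq hd.le, mul_assoc]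

theorem wave_mul_cos {j : ℕ} {R θ : ℝ} (hR : 0 < R) (hθ : θ ∈ Icc 0 Real.pi) :
    wave j R (R * Real.cos θ) = R * Real.sin ((2 * (j : ℝ) + 1) * θ) := by
  unfold wave
  have hs : 0 ≤ Real.sin θ := Real.sin_nonneg_of_mem_Icc hθ
  have h1 : R ^ 2 - (R * Real.cos θ) ^ 2 = (R * Real.sin θ) ^ 2 := by
    rw [mul_pow, mul_pow, Real.sin_sq]
    ring
  have h2 := Polynomial.Chebyshev.U_real_cos θ ((2 * j : ℕ) : ℤ)
  push_cast at h2
  rw [h1, Real.sqrt_sq (mul_nonneg hR.le hs), mul_div_cancel_left₀ _ hR.ne', ← h2]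
  push_cast
  ring

theorem wave_zero {j : ℕ} {R : ℝ} (hR : 0 < R) : wave j R 0 = (-1) ^ j * R := by
  have h := wave_mul_cos (j := j) hR (θ := Real.pi / 2)
    ⟨by positivity, by linarith [Real.pi_pos]⟩
  rw [Real.cos_pi_div_two, mul_zero] at h
  rw [h, show (2 * (j : ℝ) + 1) * (Real.pi / 2) = Real.pi / 2 + j * Real.pi by ring,
    Real.sin_add_nat_mul_pi, Real.sin_pi_div_two]
  ring

theorem fourier_wave {j : ℕ} {R : ℝ} (hR : 0 < R) (t : ℝ) :
    𝓕 (fun x : ℝ => (wave j R x : ℂ)) t = waveFourier j R t := by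
  rw [Real.fourier_real_eq_integral_exp_smul]
  set g : ℝ → ℂ := fun v => Complex.exp (↑(-2 * Real.pi * v * t) * Complex.I) • (wave j R v : ℂ)
    with hg
  have hwc := continuous_wave j R
  have hgc : Continuous g := by fun_prop
  have hsupp : Function.support g ⊆ Ioc (-R) R := by
    intro v hv
    by_contra hcon
    apply hv
    have hle : R ≤ |v| := by
      by_contra hlt
      rw [not_le, abs_lt] at hlt
      exact hcon ⟨hlt.1, hlt.2.le⟩
    simp [hg, wave_eq_zero hR.le hle]
  rw [← intervalIntegral.integral_eq_integral_of_support_subset hsupp]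
  have hsub := intervalIntegral.integral_deriv_smul_comp (a := 0) (b := Real.pi)
    (f := fun θ : ℝ => R * Real.cos θ) (f' := fun θ => R * -Real.sin θ) (g := g)
    (fun θ _ => (Real.hasDerivAt_cos θ).const_mul R) (by fun_prop) hgc
  simp only [Real.cos_zero, Real.cos_pi, mul_one, mul_neg] at hsub
  rw [intervalIntegral.integral_symm, ← hsub, ← intervalIntegral.integral_neg]
  have hzero : ∫ θ in (0 : ℝ)..Real.pi, Real.sin ((2 * (j : ℝ) + 1) * θ) * Real.sin θ *
      Real.sin (2 * Real.pi * R * t * Real.cos θ) = 0 := by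
    refine integral_zero_pi_eq_zero_of_reflect fun θ => ?_
    rw [mul_sub, sin_odd_mul_pi_sub, Real.sin_pi_sub, Real.cos_pi_sub, mul_neg, Real.sin_neg]
    ring
  have hcongr : ∫ θ in (0 : ℝ)..Real.pi, -((-(R * Real.sin θ)) • (g ∘ fun θ => R * Real.cos θ) θ) =
      ∫ θ in (0 : ℝ)..Real.pi,
        (((R ^ 2 * (Real.sin ((2 * (j : ℝ) + 1) * θ) * Real.sin θ *
          Real.cos (2 * Real.pi * R * t * Real.cos θ)) : ℝ) : ℂ) -
        Complex.I * ((R ^ 2 * (Real.sin ((2 * (j : ℝ) + 1) * θ) * Real.sin θ *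
          Real.sin (2 * Real.pi * R * t * Real.cos θ)) : ℝ) : ℂ)) := by
    refine intervalIntegral.integral_congr fun θ hθ => ?_
    rw [uIcc_of_le Real.pi_pos.le] at hθ
    simp only [hg, Function.comp_apply, wave_mul_cos hR hθ, Complex.exp_mul_I,
      ← Complex.ofReal_cos, ← Complex.ofReal_sin]
    rw [show -2 * Real.pi * (R * Real.cos θ) * t = -(2 * Real.pi * R * t * Real.cos θ) by ring,
      Real.cos_neg, Real.sin_neg]
    simp only [smul_eq_mul, Complex.real_smul]
    push_cast
    ring
  rw [hcongr, intervalIntegral.integral_sub ((by fun_prop : Continuous _).intervalIntegrable _ _)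
    ((by fun_prop : Continuous _).intervalIntegrable _ _), intervalIntegral.integral_const_mul,
    intervalIntegral.integral_ofReal, intervalIntegral.integral_ofReal,
    intervalIntegral.integral_const_mul, intervalIntegral.integral_const_mul, hzero]
  simp [waveFourier]

theorem waveFourier_neg (j : ℕ) (R t : ℝ) : waveFourier j R (-t) = waveFourier j R t := by
  unfold waveFourier
  simp only [mul_neg, neg_mul, Real.cos_neg]

theorem waveFourier_zero (j : ℕ) (R : ℝ) :
    waveFourier j R 0 = if j = 0 then Real.pi * R ^ 2 / 2 else 0 := by
  unfold waveFourier
  simp only [mul_zero, zero_mul, Real.cos_zero, mul_one, integral_sin_mul_sin_zero]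
  split_ifs <;> ring

theorem waveFourier_eq_besselJ {R t : ℝ} (hR : 0 < R) (ht : 0 < t) (j : ℕ) :
    waveFourier j R t =
      (-1) ^ j * (2 * j + 1) * R / 2 * (besselJ (2 * j + 1) (2 * Real.pi * R * t) / t) := by
  have h := mul_integral_sin_mul_sin_mul_cos j (2 * Real.pi * R * t)
  unfold waveFourier
  have hne : 2 * Real.pi * R * t ≠ 0 := by positivity
  rw [eq_div_of_mul_eq hne ((mul_comm _ _).trans h)]
  field_simp

theorem summable_besselJ_div {R : ℝ} (hR : 0 < R) (j : ℕ) :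
    Summable fun s : ℕ+ => besselJ (2 * j + 1) (2 * Real.pi * R * s) / (s : ℝ) := by
  obtain ⟨C, hC0, hC⟩ := exists_abs_besselJ_odd_le j
  have hs : Summable fun s : ℕ+ => C / √(2 * Real.pi * R) * (1 / (s : ℝ) ^ (3 / 2 : ℝ)) := by
    refine Summable.mul_left _ ?_
    exact (summable_pnat_iff_summable_nat (f := fun n : ℕ => 1 / (n : ℝ) ^ (3 / 2 : ℝ))).2
      (Real.summable_one_div_nat_rpow.2 (by norm_num))
  refine Summable.of_norm_bounded hs fun s => ?_
  have hs0 : (0 : ℝ) < s := by exact_mod_cast s.pos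
  have h := hC (2 * Real.pi * R * s) (by positivity)
  rw [Real.norm_eq_abs, abs_div, abs_of_pos hs0]
  calc _ ≤ C / √(2 * Real.pi * R * s) / s := by gcongr
    _ = _ := by
      rw [show (3 / 2 : ℝ) = 1 / 2 + 1 by norm_num, Real.rpow_add hs0, ← Real.sqrt_eq_rpow,
        Real.rpow_one, Real.sqrt_mul (by positivity)]
      field_simp

/-- Poisson summation for the Chebyshev summand of the density. -/
theorem tsum_wave {R : ℝ} (hR : 0 < R) (j : ℕ) :
    ∑' m : ℕ+, wave j R m =
      (if j = 0 then Real.pi * R ^ 2 / 4 else 0) - (-1) ^ j * R / 2 +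
        (-1) ^ j * (2 * j + 1) * R / 2 *
          ∑' s : ℕ+, besselJ (2 * j + 1) (2 * Real.pi * R * s) / (s : ℝ) := by
  have hpos : ∀ s : ℕ+, waveFourier j R ((s : ℕ) : ℤ) = (-1) ^ j * (2 * j + 1) * R / 2 *
      (besselJ (2 * j + 1) (2 * Real.pi * R * s) / (s : ℝ)) := by
    intro s
    have hs0 : (0 : ℝ) < s := by exact_mod_cast s.pos
    rw [Int.cast_natCast, waveFourier_eq_besselJ hR hs0]
  have hFpos : Summable fun s : ℕ+ => waveFourier j R ((s : ℕ) : ℤ) := by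
    simp only [hpos]
    exact (summable_besselJ_div hR j).mul_left _
  have hFnat : Summable fun n : ℕ => waveFourier j R ((n : ℕ) : ℤ) :=
    (summable_pnat_iff_summable_nat (f := fun n : ℕ => waveFourier j R ((n : ℕ) : ℤ))).1 hFpos
  have hFint : Summable fun n : ℤ => waveFourier j R n := by
    refine summable_int_iff_summable_nat_and_neg.2 ⟨hFnat, ?_⟩
    simpa [waveFourier_neg] using hFnat
  -- Both sides of the Poisson formula are sums of even sequences; the left one is finite and the
  -- right one converges because `J(x) = O(x ^ (-1/2))`.
  have hfin : (Function.support fun n : ℤ => wave j R n).Finite := by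
    refine (Set.finite_Icc (-⌈R⌉) ⌈R⌉).subset fun n hn => ?_
    have hlt : |(n : ℝ)| < R := by
      by_contra hcon
      exact hn (wave_eq_zero hR.le (not_lt.1 hcon))
    have h1 := abs_lt.1 hlt
    have h2 := Int.le_ceil R
    constructor
    · have : (-⌈R⌉ : ℝ) < n := by linarith [h1.1]
      exact_mod_cast this.le
    · have : (n : ℝ) < ⌈R⌉ := by linarith [h1.2]
      exact_mod_cast this.le
  have hwint : Summable fun n : ℤ => wave j R n := summable_of_hasFiniteSupport hfin
  have hPoisson : ∑' n : ℤ, wave j R n = ∑' n : ℤ, waveFourier j R n := by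
    have hdecay : (fun x : ℝ => (wave j R x : ℂ)) =O[cocompact ℝ] fun x : ℝ => |x| ^ (-2 : ℝ) := by
      refine IsBigO.of_bound 0 ?_
      filter_upwards [(isCompact_Icc (a := -R) (b := R)).compl_mem_cocompact] with x hx
      have : R ≤ |x| := by
        by_contra hlt
        rw [not_le, abs_lt] at hlt
        exact hx ⟨hlt.1.le, hlt.2.le⟩
      simp [wave_eq_zero hR.le this]
    have h := Real.tsum_eq_tsum_fourier_of_rpow_decay_of_summable
      (f := fun x : ℝ => (wave j R x : ℂ))
      (Complex.continuous_ofReal.comp (continuous_wave j R)) one_lt_two hdecay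
      (by simpa only [fourier_wave hR] using Complex.summable_ofReal.2 hFint) 0
    simp only [fourier_wave hR, zero_add, QuotientAddGroup.mk_zero, fourier_eval_zero, mul_one,
      ← Complex.ofReal_tsum] at h
    exact_mod_cast h
  rw [tsum_int_eq_zero_add_two_mul_tsum_pnat (fun n => by push_cast; exact wave_neg j R _) hwint,
    tsum_int_eq_zero_add_two_mul_tsum_pnat (fun n => by push_cast; exact waveFourier_neg j R _)
      hFint] at hPoisson
  simp only [hpos, tsum_mul_left, Int.cast_zero, wave_zero hR, waveFourier_zero] at hPoisson
  simp only [Int.cast_natCast, two_nsmul] at hPoisson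
  split_ifs at hPoisson ⊢ <;> linarith

end Poisson

/-! ### Arithmetic of `Q` and the Euler products -/

section Arithmetic

open Set Topology

theorem localQ_denom_pos {p : ℕ} (hp : 2 ≤ p) :
    0 < (p : ℝ) ^ 4 - 2 * (p : ℝ) ^ 2 - (p : ℝ) + 1 := by
  have h : (2 : ℝ) ≤ p := by exact_mod_cast hp
  have h2 : 4 ≤ (p : ℝ) ^ 2 := by nlinarith
  nlinarith [mul_le_mul h2 h2 (by norm_num) (by positivity),
    mul_nonneg (sub_nonneg.2 h2) (sq_nonneg (p : ℝ))]

theorem localQ_pos {p : ℕ} (hp : 2 ≤ p) : 0 < localQ p := by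
  have h : (2 : ℝ) ≤ p := by exact_mod_cast hp
  exact div_pos (by positivity) (localQ_denom_pos hp)

theorem inv_sq_le_localQ {p : ℕ} (hp : 2 ≤ p) : 1 / (p : ℝ) ^ 2 ≤ localQ p := by
  have h : (2 : ℝ) ≤ p := by exact_mod_cast hp
  unfold localQ
  rw [div_le_div_iff₀ (by positivity) (localQ_denom_pos hp)]
  nlinarith

theorem localQ_le {p : ℕ} (hp : 2 ≤ p) :
    localQ p ≤ 1 / (p : ℝ) ^ 2 * (1 + 6 / (p : ℝ) ^ 2) := by
  have h : (2 : ℝ) ≤ p := by exact_mod_cast hp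
  unfold localQ
  have hp0 : (0 : ℝ) < p := by linarith
  rw [show 1 / (p : ℝ) ^ 2 * (1 + 6 / (p : ℝ) ^ 2) = ((p : ℝ) ^ 2 + 6) / (p : ℝ) ^ 4 by
    field_simp, div_le_div_iff₀ (localQ_denom_pos hp) (by positivity)]
  obtain ⟨t, ht0, ht⟩ : ∃ t : ℝ, 0 ≤ t ∧ (p : ℝ) = 2 + t := ⟨p - 2, by linarith, by ring⟩
  rw [ht]
  -- The expansion of `(p² + 6) (p⁴ - 2 p² - p + 1) - p⁶` in powers of `t = p - 2`.
  have : 0 ≤ 6 + 66 * t + 79 * t ^ 2 + 31 * t ^ 3 + 4 * t ^ 4 := by positivity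
  nlinarith

theorem moebius_sq_cast_of_squarefree {d : ℕ} (h : Squarefree d) :
    (ArithmeticFunction.moebius d : ℝ) ^ 2 = 1 := by
  exact_mod_cast ArithmeticFunction.moebius_sq_eq_one_of_squarefree h

theorem Q_of_squarefree {d : ℕ} (h : Squarefree d) : Q d = ∏ p ∈ d.primeFactors, localQ p := by
  rw [Q, moebius_sq_cast_of_squarefree h, one_mul]

theorem Q_of_not_squarefree {d : ℕ} (h : ¬Squarefree d) : Q d = 0 := by
  simp [Q, ArithmeticFunction.moebius_eq_zero_of_not_squarefree h]

theorem Q_nonneg (d : ℕ) : 0 ≤ Q d :=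
  mul_nonneg (sq_nonneg _) (Finset.prod_nonneg fun _ hp =>
    (localQ_pos (Nat.prime_of_mem_primeFactors hp).two_le).le)

theorem moebius_sq_div_sq_le_Q (d : ℕ) :
    (ArithmeticFunction.moebius d : ℝ) ^ 2 / (d : ℝ) ^ 2 ≤ Q d := by
  by_cases h : Squarefree d
  · rw [moebius_sq_cast_of_squarefree h, Q_of_squarefree h]
    nth_rw 1 [← Nat.prod_primeFactors_of_squarefree h]
    rw [Nat.cast_prod, ← Finset.prod_pow, one_div, ← Finset.prod_inv_distrib]
    refine Finset.prod_le_prod (fun _ _ => by positivity) fun p hp => ?_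
    rw [← one_div]
    exact inv_sq_le_localQ (Nat.prime_of_mem_primeFactors hp).two_le
  · rw [Q_of_not_squarefree h, ArithmeticFunction.moebius_eq_zero_of_not_squarefree h]
    simp

/-- The constant comes from `∏ (1 + 6 / p²) ≤ exp (6 ∑ 1 / n²) = exp π²`. -/
theorem Q_le_moebius_sq_div_sq (d : ℕ) :
    Q d ≤ Real.exp (Real.pi ^ 2) * ((ArithmeticFunction.moebius d : ℝ) ^ 2 / (d : ℝ) ^ 2) := by
  by_cases h : Squarefree d
  · rw [moebius_sq_cast_of_squarefree h, Q_of_squarefree h]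
    nth_rw 2 [← Nat.prod_primeFactors_of_squarefree h]
    rw [Nat.cast_prod, ← Finset.prod_pow, one_div, ← Finset.prod_inv_distrib, mul_comm]
    calc ∏ p ∈ d.primeFactors, localQ p
        ≤ ∏ p ∈ d.primeFactors, (((p : ℝ) ^ 2)⁻¹ * Real.exp (6 * (1 / (p : ℝ) ^ 2))) := by
          refine Finset.prod_le_prod
            (fun p hp => (localQ_pos (Nat.prime_of_mem_primeFactors hp).two_le).le) fun p hp => ?_
          refine (localQ_le (Nat.prime_of_mem_primeFactors hp).two_le).trans ?_
          rw [one_div, ← div_eq_mul_inv 6]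
          gcongr
          rw [add_comm]
          exact Real.add_one_le_exp _
      _ = (∏ p ∈ d.primeFactors, ((p : ℝ) ^ 2)⁻¹) *
            Real.exp (6 * ∑ p ∈ d.primeFactors, 1 / (p : ℝ) ^ 2) := by
          rw [Finset.prod_mul_distrib, ← Real.exp_sum, Finset.mul_sum]
      _ ≤ _ := by
          gcongr
          have := sum_le_hasSum d.primeFactors (fun n _ => by positivity) hasSum_zeta_two
          linarith
  · rw [Q_of_not_squarefree h]
    positivity

theorem Q_le_inv_sq (d : ℕ) : Q d ≤ Real.exp (Real.pi ^ 2) * (1 / (d : ℝ) ^ 2) := by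
  refine (Q_le_moebius_sq_div_sq d).trans ?_
  gcongr
  by_cases h : Squarefree d
  · rw [moebius_sq_cast_of_squarefree h]
  · simp [ArithmeticFunction.moebius_eq_zero_of_not_squarefree h]

theorem Q_zero : Q 0 = 0 := by simp [Q]

theorem Q_one : Q 1 = 1 := by simp [Q]

theorem Q_mul {m n : ℕ} (h : Nat.Coprime m n) : Q (m * n) = Q m * Q n := by
  unfold Q
  rw [ArithmeticFunction.isMultiplicative_moebius.map_mul_of_coprime h, h.primeFactors_mul,
    Finset.prod_union h.disjoint_primeFactors]
  push_cast
  ring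

theorem Q_prime {p : ℕ} (hp : p.Prime) : Q p = localQ p := by
  rw [Q_of_squarefree hp.squarefree, hp.primeFactors, Finset.prod_singleton]

theorem Q_prime_pow {p e : ℕ} (hp : p.Prime) (he : 2 ≤ e) : Q (p ^ e) = 0 := by
  refine Q_of_not_squarefree fun h => ?_
  rcases (Nat.squarefree_pow_iff hp.ne_one (by omega)).1 h with ⟨_, h1⟩
  omega

theorem summable_Q : Summable Q :=
  Summable.of_nonneg_of_le Q_nonneg Q_le_inv_sq
    ((Real.summable_one_div_nat_pow.2 one_lt_two).mul_left _)

theorem summable_Q_div : Summable fun d : ℕ => Q d / d := by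
  refine Summable.of_nonneg_of_le (fun d => div_nonneg (Q_nonneg d) d.cast_nonneg) (fun d => ?_)
    summable_Q
  rcases Nat.eq_zero_or_pos d with rfl | hd
  · simp [Q_zero]
  · exact div_le_self (Q_nonneg d) (by exact_mod_cast hd)

theorem hasProd_one_add_localQ :
    HasProd (fun p : Nat.Primes => 1 + localQ p) (∑' d : ℕ, Q d) := by
  have h := EulerProduct.eulerProduct_hasProd (f := Q) Q_one (fun h => Q_mul h)
    summable_Q.norm Q_zero
  convert! h using 2 with p
  rw [tsum_eq_sum (s := Finset.range 2) fun e he =>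
    Q_prime_pow p.2 (by rw [Finset.mem_range] at he; omega)]
  simp [Finset.sum_range_succ, Q_one, Q_prime p.2]

theorem hasProd_one_add_localQ_div :
    HasProd (fun p : Nat.Primes => 1 + localQ p / p) (∑' d : ℕ, Q d / d) := by
  have h := EulerProduct.eulerProduct_hasProd (f := fun d => Q d / d) (by simp [Q_one])
    (fun h => by rw [Q_mul h]; push_cast; ring) summable_Q_div.norm (by simp)
  convert! h using 2 with p
  rw [tsum_eq_sum (s := Finset.range 2) fun e he => by
    rw [Q_prime_pow p.2 (by rw [Finset.mem_range] at he; omega), zero_div]]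
  simp [Finset.sum_range_succ, Q_one, Q_prime p.2]

/-- The factors of `α` are `1 - O(p⁻³)`; the cruder `1 - O(p⁻²)` suffices. -/
theorem multipliable_alpha_factor : Multipliable fun p : Nat.Primes =>
    (1 - (p : ℝ) - 2 * (p : ℝ) ^ 2 + (p : ℝ) ^ 4) /
      ((p : ℝ) ^ 4 - 2 * (p : ℝ) ^ 2 + (p : ℝ)) := by
  have hs : Summable fun p : Nat.Primes => 2 * (1 / ((p : ℕ) : ℝ) ^ 2) :=
    ((Real.summable_one_div_nat_pow.2 one_lt_two).comp_injective
      Nat.Primes.coe_nat_injective).mul_left 2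
  have hden : ∀ p : Nat.Primes, 0 < ((p : ℕ) : ℝ) ^ 4 - 2 * (p : ℝ) ^ 2 + p := fun p => by
    have h := localQ_denom_pos p.2.two_le
    have h1 : (2 : ℝ) ≤ (p : ℕ) := by exact_mod_cast p.2.two_le
    linarith
  have hsum : Summable fun p : Nat.Primes =>
      -((2 * ((p : ℕ) : ℝ) - 1) / ((p : ℝ) ^ 4 - 2 * (p : ℝ) ^ 2 + p)) := by
    refine Summable.of_norm_bounded hs fun p => ?_
    have h1 : (2 : ℝ) ≤ (p : ℕ) := by exact_mod_cast p.2.two_le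
    have h2 : (0 : ℝ) < (p : ℕ) := by linarith
    rw [norm_neg, Real.norm_eq_abs, abs_of_nonneg (div_nonneg (by linarith) (hden p).le),
      mul_one_div, div_le_div_iff₀ (hden p) (by positivity)]
    obtain ⟨t, ht0, ht⟩ : ∃ t : ℝ, 0 ≤ t ∧ ((p : ℕ) : ℝ) = 2 + t := ⟨p - 2, by linarith, by ring⟩
    rw [ht]
    -- The expansion of the difference of the two sides in powers of `t = p - 2`.
    have : 0 ≤ 8 + 30 * t + 33 * t ^ 2 + 14 * t ^ 3 + 2 * t ^ 4 := by positivity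
    nlinarith
  refine (Real.multipliable_one_add_of_summable hsum).congr fun p => ?_
  rw [← sub_eq_add_neg, eq_div_iff (hden p).ne', sub_mul, div_mul_cancel₀ _ (hden p).ne']
  ring

theorem prime_quadratic_pos (p : Nat.Primes) : 0 < -1 + ((p : ℕ) : ℝ) + (p : ℝ) ^ 2 := by
  have h1 : (2 : ℝ) ≤ (p : ℕ) := by exact_mod_cast p.2.two_le
  nlinarith

/-- `β / α` is the Euler product of `∑ Q(d)`. -/
theorem beta_eq : beta = alpha * ∑' d : ℕ, Q d := by
  have h := multipliable_alpha_factor.hasProd.mul hasProd_one_add_localQ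
  unfold beta alpha
  rw [mul_assoc (2 * Real.pi), ← h.tprod_eq]
  congr 1
  refine tprod_congr fun p => ?_
  have h1 : (2 : ℝ) ≤ (p : ℕ) := by exact_mod_cast p.2.two_le
  have hp : ((p : ℕ) : ℝ) ≠ 0 := by linarith
  have hp1 : ((p : ℕ) : ℝ) - 1 ≠ 0 := by linarith
  have hq := (prime_quadratic_pos p).ne'
  have hd := (localQ_denom_pos p.2.two_le).ne'
  have hden : ((p : ℕ) : ℝ) ^ 4 - 2 * (p : ℝ) ^ 2 + p =
      p * ((p - 1) * (-1 + (p : ℝ) + (p : ℝ) ^ 2)) := by ring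
  rw [hden]
  unfold localQ
  generalize ((p : ℕ) : ℝ) = x at *
  rw [one_add_div hd, show 1 - x - 2 * x ^ 2 + x ^ 4 = x ^ 4 - 2 * x ^ 2 - x + 1 by ring,
    div_mul_div_comm, mul_comm (x * _), mul_div_mul_left _ _ hd]
  field_simp
  ring

/-- `γ / (π α)` is the Euler product of `∑ Q(d) / d`; the factor `ζ(2) = π² / 6` accounts for the
rational constant. -/
theorem gamma_eq : gamma = Real.pi * alpha * ∑' d : ℕ, Q d / d := by
  have hz : HasProd (fun p : Nat.Primes => (1 - 1 / ((p : ℕ) : ℝ) ^ 2)⁻¹) (Real.pi ^ 2 / 6) := by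
    let f : ℕ →*₀ ℝ :=
      { toFun := fun n => 1 / (n : ℝ) ^ 2
        map_zero' := by simp
        map_one' := by simp
        map_mul' := fun m n => by push_cast; field_simp }
    have h := EulerProduct.eulerProduct_completely_multiplicative_hasProd (f := f)
      hasSum_zeta_two.summable.norm
    have hv : ∑' n, f n = Real.pi ^ 2 / 6 := hasSum_zeta_two.tsum_eq
    rw [hv] at h
    exact h
  have h := (multipliable_alpha_factor.hasProd.mul hasProd_one_add_localQ_div).mul hz
  unfold gamma alpha
  have hcongr : ∏' p : Nat.Primes, ((p : ℕ) : ℝ) * (1 + (p : ℝ)) / (-1 + (p : ℝ) + (p : ℝ) ^ 2) =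
      _ := (tprod_congr fun p => ?_).trans h.tprod_eq
  · rw [hcongr]
    ring
  · have h1 : (2 : ℝ) ≤ (p : ℕ) := by exact_mod_cast p.2.two_le
    have hp : ((p : ℕ) : ℝ) ≠ 0 := by linarith
    have hp1 : ((p : ℕ) : ℝ) - 1 ≠ 0 := by linarith
    have hp2 : ((p : ℕ) : ℝ) + 1 ≠ 0 := by linarith
    have hq := (prime_quadratic_pos p).ne'
    have hd := (localQ_denom_pos p.2.two_le).ne'
    have hden : ((p : ℕ) : ℝ) ^ 4 - 2 * (p : ℝ) ^ 2 + p =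
        p * ((p - 1) * (-1 + (p : ℝ) + (p : ℝ) ^ 2)) := by ring
    have hz1 : (1 - 1 / ((p : ℕ) : ℝ) ^ 2)⁻¹ = (p : ℝ) ^ 2 / ((p - 1) * (p + 1)) := by
      rw [inv_eq_iff_eq_inv, inv_div]
      field_simp
      ring
    rw [hden, hz1]
    unfold localQ
    generalize ((p : ℕ) : ℝ) = x at *
    rw [div_right_comm, sq x, mul_div_cancel_right₀ _ hp, ← sq x, one_add_div hd,
      show 1 - x - 2 * x ^ 2 + x ^ 4 = x ^ 4 - 2 * x ^ 2 - x + 1 by ring,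
      div_mul_div_comm _ _ _ (x ^ 4 - 2 * x ^ 2 - x + 1), mul_comm (x * _),
      mul_div_mul_left _ _ hd]
    field_simp
    ring

/-- Expanding the product that defines `ν(r)` over the squarefree divisors of `r`. -/
theorem nu_eq_sum_divisors {r : ℕ} (hr : r ≠ 0) : nu r = ∑ d ∈ r.divisors, Q d := by
  unfold nu
  rw [Finset.prod_one_add]
  have hsub : ∑ d ∈ r.divisors, Q d = ∑ d ∈ r.divisors with Squarefree d, Q d := by
    rw [Finset.sum_filter]
    refine Finset.sum_congr rfl fun d _ => ?_
    split_ifs with h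
    · rfl
    · exact Q_of_not_squarefree h
  have hprime : ∀ T ∈ r.primeFactors.powerset, ∀ p ∈ T, p.Prime := fun T hT p hp =>
    Nat.prime_of_mem_primeFactors (Finset.mem_powerset.1 hT hp)
  rw [hsub]
  symm
  refine Finset.sum_bij' (fun d _ => d.primeFactors) (fun T _ => ∏ p ∈ T, p) ?_ ?_ ?_ ?_ ?_
  · intro d hd
    simp only [Finset.mem_filter, Nat.mem_divisors] at hd
    exact Finset.mem_powerset.2 (Nat.primeFactors_mono hd.1.1 hr)
  · intro T hT
    simp only [Finset.mem_filter, Nat.mem_divisors]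
    refine ⟨⟨(Finset.prod_dvd_prod_of_subset _ _ _ (Finset.mem_powerset.1 hT)).trans
      (Nat.prod_primeFactors_dvd r), hr⟩, ?_⟩
    refine Finset.squarefree_prod_of_pairwise_isCoprime (fun p hp q hq hpq => ?_)
      fun p hp => (hprime T hT p hp).squarefree
    exact Nat.coprime_iff_isRelPrime.1
      ((Nat.coprime_primes (hprime T hT p hp) (hprime T hT q hq)).2 hpq)
  · intro d hd
    exact Nat.prod_primeFactors_of_squarefree (Finset.mem_filter.1 hd).2
  · intro T hT
    exact Nat.primeFactors_prod (hprime T hT)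
  · intro d hd
    exact Q_of_squarefree (Finset.mem_filter.1 hd).2

end Arithmetic

/-! ### The Bessel expansion -/

section BesselExpansion

open Set Topology

theorem tsum_pnat_eq_sum_Icc {f : ℕ → ℝ} {N : ℕ} (hf : ∀ n, N < n → f n = 0) :
    ∑' n : ℕ+, f n = ∑ n ∈ Finset.Icc 1 N, f n := by
  rw [tsum_pnat_eq_tsum_succ (f := f), tsum_eq_sum (s := Finset.range N) fun n hn => hf _ (by
    rw [Finset.mem_range] at hn; omega)]
  refine Finset.sum_bij (fun n _ => n + 1) ?_ ?_ ?_ ?_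
  · intro n hn
    simp only [Finset.mem_range, Finset.mem_Icc] at hn ⊢
    omega
  · intro a _ b _ h
    omega
  · intro b hb
    rw [Finset.mem_Icc] at hb
    exact ⟨b - 1, by rw [Finset.mem_range]; omega, by omega⟩
  · intro n _
    rfl

/-- Exchange of summation in a divisor sum, for a summand vanishing beyond `N`. -/
theorem sum_Icc_sum_divisors {F : ℕ → ℕ → ℝ} {N : ℕ} (hF : ∀ d r, N < r → F d r = 0) :
    ∑ r ∈ Finset.Icc 1 N, ∑ d ∈ r.divisors, F d r =
      ∑ d ∈ Finset.Icc 1 N, ∑ m ∈ Finset.Icc 1 N, F d (d * m) := by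
  have hfilter : ∑ p ∈ Finset.Icc 1 N ×ˢ Finset.Icc 1 N, F p.1 (p.1 * p.2) =
      ∑ p ∈ Finset.Icc 1 N ×ˢ Finset.Icc 1 N with p.1 * p.2 ≤ N, F p.1 (p.1 * p.2) := by
    rw [Finset.sum_filter]
    refine Finset.sum_congr rfl fun p _ => ?_
    split_ifs with h
    · rfl
    · exact hF _ _ (not_le.1 h)
  rw [← Finset.sum_product', hfilter, Finset.sum_sigma']
  refine Finset.sum_bij' (fun p _ => (p.2, p.1 / p.2)) (fun p _ => ⟨p.1 * p.2, p.1⟩) ?_ ?_ ?_ ?_ ?_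
  · rintro ⟨r, d⟩ h
    simp only [Finset.mem_sigma, Finset.mem_Icc, Nat.mem_divisors] at h
    obtain ⟨⟨h1, hN⟩, ⟨m, rfl⟩, h0⟩ := h
    have hd : 0 < d := Nat.pos_of_ne_zero fun h => h0 (by simp [h])
    have hm : 0 < m := Nat.pos_of_ne_zero fun h => h0 (by simp [h])
    simp only [Finset.mem_filter, Finset.mem_product, Finset.mem_Icc, Nat.mul_div_cancel_left m hd]
    refine ⟨⟨⟨hd, ?_⟩, hm, ?_⟩, hN⟩
    · nlinarith
    · nlinarith
  · rintro ⟨d, m⟩ h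
    simp only [Finset.mem_filter, Finset.mem_product, Finset.mem_Icc] at h
    simp only [Finset.mem_sigma, Finset.mem_Icc, Nat.mem_divisors]
    have := Nat.mul_pos h.1.1.1 h.1.2.1
    exact ⟨⟨this, h.2⟩, dvd_mul_right _ _, this.ne'⟩
  · rintro ⟨r, d⟩ h
    simp only [Finset.mem_sigma, Finset.mem_Icc, Nat.mem_divisors] at h
    simp [Nat.mul_div_cancel' h.2.1]
  · rintro ⟨d, m⟩ h
    simp only [Finset.mem_filter, Finset.mem_product, Finset.mem_Icc] at h
    simp [Nat.mul_div_cancel_left m h.1.1.1]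
  · rintro ⟨r, d⟩ h
    simp only [Finset.mem_sigma, Finset.mem_Icc, Nat.mem_divisors] at h
    simp [Nat.mul_div_cancel' h.2.1]

theorem rpow_three_halves {s : ℝ} (hs : 0 < s) : s ^ (3 / 2 : ℝ) = √s * s := by
  rw [show (3 / 2 : ℝ) = 1 / 2 + 1 by norm_num, Real.rpow_add hs, ← Real.sqrt_eq_rpow,
    Real.rpow_one]

/-- `∑ Q(d) √d s ^ (-3/2)`, which dominates both double series. -/
theorem summable_Q_mul_sqrt_div :
    Summable fun p : ℕ+ × ℕ+ => Q p.1 * √(p.1 : ℝ) / (p.2 : ℝ) ^ (3 / 2 : ℝ) := by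
  have h32 : Summable fun s : ℕ+ => 1 / (s : ℝ) ^ (3 / 2 : ℝ) :=
    (summable_pnat_iff_summable_nat (f := fun n : ℕ => 1 / (n : ℝ) ^ (3 / 2 : ℝ))).2
      (Real.summable_one_div_nat_rpow.2 (by norm_num))
  have hQ : Summable fun d : ℕ+ => Q d * √(d : ℝ) := by
    refine Summable.of_nonneg_of_le (fun d => mul_nonneg (Q_nonneg d) (Real.sqrt_nonneg _))
      (fun d => ?_) (h32.mul_left (Real.exp (Real.pi ^ 2)))
    have hd : (0 : ℝ) < d := by exact_mod_cast d.pos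
    have hsq : √(d : ℝ) ^ 2 = d := Real.sq_sqrt hd.le
    have hsd : 0 < √(d : ℝ) := Real.sqrt_pos.2 hd
    calc Q d * √(d : ℝ) ≤ Real.exp (Real.pi ^ 2) * (1 / ((d : ℕ) : ℝ) ^ 2) * √(d : ℝ) := by
          gcongr
          exact Q_le_inv_sq d
      _ = _ := by
          rw [rpow_three_halves hd]
          field_simp
          linear_combination hsq
  have h := Summable.mul_of_nonneg hQ h32 (fun d => mul_nonneg (Q_nonneg d) (Real.sqrt_nonneg _))
    (fun s => by positivity)
  simpa only [mul_one_div] using h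

theorem abs_cosTerm_le (y : ℝ) (d s : ℕ+) :
    |cosTerm y d s| ≤ Q d * √(d : ℝ) / (s : ℝ) ^ (3 / 2 : ℝ) := by
  have h0 : 0 ≤ Q d * √(d : ℝ) / (s : ℝ) ^ (3 / 2 : ℝ) :=
    div_nonneg (mul_nonneg (Q_nonneg d) (Real.sqrt_nonneg _)) (by positivity)
  unfold cosTerm
  rw [abs_mul, abs_of_nonneg h0]
  exact mul_le_of_le_one_right h0 (Real.abs_cos_le_one _)

theorem summable_abs_cosTerm (y : ℝ) :
    Summable fun p : ℕ+ × ℕ+ => |cosTerm y p.1 p.2| :=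
  Summable.of_nonneg_of_le (fun _ => abs_nonneg _) (fun p => abs_cosTerm_le y p.1 p.2)
    summable_Q_mul_sqrt_div

theorem besselTerm_eq (j : ℕ) (y : ℝ) (d s : ℕ+) :
    besselTerm (2 * j + 2) y d s =
      Q d * (besselJ (2 * j + 1) (4 * Real.pi * (s : ℝ) * √y / (d : ℝ)) / (s : ℝ)) := by
  unfold besselTerm
  rw [show (((2 * j + 2 : ℕ) : ℤ) - 1) = 2 * j + 1 by push_cast; ring]

theorem besselTerm_zero (j : ℕ) (d s : ℕ+) : besselTerm (2 * j + 2) 0 d s = 0 := by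
  rw [besselTerm_eq]
  simp [besselJ_odd_zero]

theorem summable_abs_besselTerm (j : ℕ) {y : ℝ} (hy : 0 ≤ y) :
    Summable fun p : ℕ+ × ℕ+ => |besselTerm (2 * j + 2) y p.1 p.2| := by
  rcases hy.eq_or_lt with rfl | hy
  · simp [besselTerm_zero, summable_zero]
  obtain ⟨C, hC0, hC⟩ := exists_abs_besselJ_odd_le j
  refine Summable.of_nonneg_of_le (fun _ => abs_nonneg _) (fun p => ?_)
    (summable_Q_mul_sqrt_div.mul_left (C / √(4 * Real.pi * √y)))
  obtain ⟨d, s⟩ := p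
  have hd : (0 : ℝ) < d := by exact_mod_cast d.pos
  have hs : (0 : ℝ) < s := by exact_mod_cast s.pos
  have hsy : 0 < √y := Real.sqrt_pos.2 hy
  have hsd : 0 < √(d : ℝ) := Real.sqrt_pos.2 hd
  have hx : 0 < 4 * Real.pi * (s : ℝ) * √y / (d : ℝ) := by positivity
  have hQ := Q_nonneg d
  rw [besselTerm_eq, abs_mul, abs_div, abs_of_nonneg hQ, abs_of_pos hs]
  calc _ ≤ Q d * (C / √(4 * Real.pi * (s : ℝ) * √y / (d : ℝ)) / s) := by
        gcongr
        exact hC _ hx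
    _ = _ := by
        rw [show 4 * Real.pi * (s : ℝ) * √y / (d : ℝ) = (4 * Real.pi * √y) * s / d by ring,
          Real.sqrt_div (by positivity), Real.sqrt_mul (by positivity), rpow_three_halves hs]
        field_simp

theorem wave_eq (j : ℕ) {y : ℝ} (hy : 0 ≤ y) (r : ℝ) :
    wave j (2 * √y) r = √(4 * y - r ^ 2) *
      (Polynomial.Chebyshev.U ℝ (((2 * j + 2 : ℕ) : ℤ) - 2)).eval (r / (2 * √y)) := by
  unfold wave
  rw [mul_pow, Real.sq_sqrt hy, show (((2 * j + 2 : ℕ) : ℤ) - 2) = ((2 * j : ℕ) : ℤ) by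
    push_cast; ring]
  norm_num

/-- Poisson summation over the multiples of `d`, from `tsum_wave` with `√y / d` in place of `√y`. -/
theorem tsum_wave_mul (j : ℕ) {y : ℝ} (hy : 0 < y) (d : ℕ+) :
    ∑' m : ℕ+, wave j (2 * √y) ((d : ℝ) * m) =
      (if j = 0 then Real.pi * y else 0) / d - (-1) ^ j * √y +
        (-1) ^ j * (2 * j + 1) * √y *
          ∑' s : ℕ+, besselJ (2 * j + 1) (4 * Real.pi * (s : ℝ) * √y / (d : ℝ)) / (s : ℝ) := by
  have hd : (0 : ℝ) < d := by exact_mod_cast d.pos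
  have hsy : 0 < √y := Real.sqrt_pos.2 hy
  have hsq : √y ^ 2 = y := Real.sq_sqrt hy.le
  simp only [wave_mul hd, tsum_mul_left]
  rw [tsum_wave (by positivity)]
  have harg : ∀ s : ℕ+, 2 * Real.pi * (2 * √y / d) * (s : ℝ) = 4 * Real.pi * s * √y / d := by
    intro s; ring
  simp only [harg]
  split_ifs
  · field_simp
    linear_combination 4 * Real.pi * hsq
  · field_simp
    ring

/-- The Chebyshev sum of the density as a double sum over `d` and the multiples of `d`. -/
theorem sum_nu_mul_wave (j : ℕ) (y : ℝ) :
    ∑ r ∈ Finset.Icc 1 ⌊2 * √y⌋₊, nu r * wave j (2 * √y) r =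
      ∑' d : ℕ+, Q d * ∑' m : ℕ+, wave j (2 * √y) ((d : ℝ) * m) := by
  set R := 2 * √y with hR
  have hR0 : 0 ≤ R := by positivity
  set N := ⌊R⌋₊ with hN
  have hvan : ∀ r : ℕ, N < r → wave j R r = 0 := fun r hr => wave_eq_zero hR0 (by
    rw [Nat.abs_cast]
    exact ((Nat.floor_lt hR0).1 hr).le)
  have hleft : ∑ r ∈ Finset.Icc 1 N, nu r * wave j R r =
      ∑ r ∈ Finset.Icc 1 N, ∑ d ∈ r.divisors, Q d * wave j R r := by
    refine Finset.sum_congr rfl fun r hr => ?_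
    rw [nu_eq_sum_divisors (by rw [Finset.mem_Icc] at hr; omega), Finset.sum_mul]
  have hinner : ∀ d : ℕ+, ∑' m : ℕ+, wave j R ((d : ℝ) * m) =
      ∑ m ∈ Finset.Icc 1 N, wave j R ((d : ℕ) * m : ℕ) := by
    intro d
    rw [← tsum_pnat_eq_sum_Icc (f := fun m : ℕ => wave j R ((d : ℕ) * m : ℕ)) fun n hn => hvan _ ?_]
    · push_cast
      rfl
    · exact hn.trans_le (Nat.le_mul_of_pos_left n d.pos)
  rw [hleft, sum_Icc_sum_divisors (F := fun d r => Q d * wave j R r) fun d r hr => by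
    rw [hvan r hr, mul_zero]]
  simp only [hinner, Finset.mul_sum]
  rw [tsum_pnat_eq_sum_Icc
    (f := fun d : ℕ => ∑ m ∈ Finset.Icc 1 N, Q d * wave j R ((d * m : ℕ) : ℝ)) fun d hd => ?_]
  refine Finset.sum_eq_zero fun m hm => ?_
  rw [hvan, mul_zero]
  exact hd.trans_le (Nat.le_mul_of_pos_right d (Finset.mem_Icc.1 hm).1)

theorem density_eq (j : ℕ) {y : ℝ} (hy : 0 ≤ y) :
    density (2 * j + 2) y = alpha * (-1) ^ j / (2 * j + 1) *
        ∑ r ∈ Finset.Icc 1 ⌊2 * √y⌋₊, nu r * wave j (2 * √y) r +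
      beta / (2 * j + 1) * √y - gamma * (if j = 0 then 1 else 0) * y := by
  unfold density
  simp only [wave_eq j hy, ← mul_assoc]
  have h1 : (2 * j + 2) / 2 - 1 = j := by omega
  have h2 : (((2 * j + 2 : ℕ) : ℝ) - 1) = 2 * j + 1 := by push_cast; ring
  have h3 : (2 * j + 2 = 2) ↔ (j = 0) := by omega
  simp only [h1, h2, h3]

/-- The Bessel expansion of the murmuration density: the terms of `tsum_wave_mul` at frequency zero
and at the origin cancel the `γ` and `β` terms of the density. -/
theorem density_eq_tsum (j : ℕ) {y : ℝ} (hy : 0 ≤ y) :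
    density (2 * j + 2) y =
      alpha * √y * ∑' p : ℕ+ × ℕ+, besselTerm (2 * j + 2) y p.1 p.2 := by
  rw [density_eq j hy]
  rcases hy.eq_or_lt with rfl | hy
  · simp
  have hsum := (summable_abs_besselTerm j hy.le).of_abs
  have hfib : ∀ d : ℕ+, ∑' s : ℕ+, besselTerm (2 * j + 2) y d s = Q d *
      ∑' s : ℕ+, besselJ (2 * j + 1) (4 * Real.pi * (s : ℝ) * √y / (d : ℝ)) / (s : ℝ) := by
    intro d
    simp only [besselTerm_eq, tsum_mul_left]
  have hB : Summable fun d : ℕ+ => ∑' s : ℕ+, besselTerm (2 * j + 2) y d s := hsum.prod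
  rw [sum_nu_mul_wave, hsum.tsum_prod]
  simp only [tsum_wave_mul j hy]
  have hterm : ∀ d : ℕ+, Q d * ((if j = 0 then Real.pi * y else 0) / (d : ℝ) - (-1) ^ j * √y +
      (-1) ^ j * (2 * j + 1) * √y *
        ∑' s : ℕ+, besselJ (2 * j + 1) (4 * Real.pi * (s : ℝ) * √y / (d : ℝ)) / (s : ℝ)) =
      (if j = 0 then Real.pi * y else 0) * (Q d / (d : ℕ)) - (-1) ^ j * √y * Q d +
      (-1) ^ j * (2 * j + 1) * √y * ∑' s : ℕ+, besselTerm (2 * j + 2) y d s := by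
    intro d
    rw [hfib]
    ring
  simp only [hterm]
  have hQ : Summable fun d : ℕ+ => Q d := (summable_pnat_iff_summable_nat (f := Q)).2 summable_Q
  have hQd : Summable fun d : ℕ+ => Q d / (d : ℕ) :=
    (summable_pnat_iff_summable_nat (f := fun d => Q d / d)).2 summable_Q_div
  rw [((hQd.mul_left _).sub (hQ.mul_left _)).tsum_add (hB.mul_left _),
    (hQd.mul_left _).tsum_sub (hQ.mul_left _), tsum_mul_left, tsum_mul_left, tsum_mul_left,
    tsum_pnat_eq_tsum_of_eq_zero (f := Q) Q_zero,
    tsum_pnat_eq_tsum_of_eq_zero (f := fun d => Q d / d) (by simp), beta_eq, gamma_eq]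
  have hsign : ((-1 : ℝ) ^ j) * (-1) ^ j = 1 := by
    rw [← mul_pow]
    norm_num
  have hj : (2 * (j : ℝ) + 1) ≠ 0 := by positivity
  split_ifs with h
  · subst h
    simp
    ring
  · field_simp
    linear_combination (alpha * √y * ((2 * j + 1) * (∑' d : ℕ+, ∑' s : ℕ+,
      besselTerm (2 * j + 2) y d s) - ∑' d : ℕ, Q d)) * hsign

end BesselExpansion

/-! ### The cosine series -/

section CosineSeries

open Set Topology

/-- The sum telescopes: the summand is at most the increment of `2 / c * (√n / (√n + c))`. -/
theorem sum_range_inv_sqrt_mul_sq_le {c : ℝ} (hc : 0 < c) (N : ℕ) :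
    ∑ n ∈ Finset.range N, 1 / (√((n + 1 : ℕ) : ℝ) * (√((n + 1 : ℕ) : ℝ) + c) ^ 2) ≤
      2 / c * (√(N : ℝ) / (√(N : ℝ) + c)) := by
  induction N with
  | zero => simp
  | succ N ih =>
    rw [Finset.sum_range_succ]
    refine (add_le_add_left ih _).trans ?_
    set a := √((N + 1 : ℕ) : ℝ) with ha
    set b := √(N : ℝ) with hb
    have hb0 : 0 ≤ b := Real.sqrt_nonneg _
    have ha0 : 0 < a := Real.sqrt_pos.2 (by positivity)
    have ha2 : a ^ 2 = N + 1 := by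
      rw [ha, Real.sq_sqrt (by positivity)]
      push_cast
      rfl
    have hb2 : b ^ 2 = N := Real.sq_sqrt (by positivity)
    have hba : b ≤ a := Real.sqrt_le_sqrt (by push_cast; linarith)
    have hdiff : 2 / c * (a / (a + c)) - 2 / c * (b / (b + c)) =
        2 * (a - b) / ((a + c) * (b + c)) := by
      field_simp
      ring
    have hkey : 1 / (a * (a + c) ^ 2) ≤ 2 * (a - b) / ((a + c) * (b + c)) := by
      have h1 : 1 / a ≤ 2 * (a - b) := by
        rw [div_le_iff₀ ha0]
        nlinarith [sq_nonneg (a - b)]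
      calc 1 / (a * (a + c) ^ 2) = 1 / a / ((a + c) * (a + c)) := by
            rw [div_div, sq]
        _ ≤ 2 * (a - b) / ((a + c) * (b + c)) := by
            have : 0 ≤ 2 * (a - b) := by linarith
            gcongr
    linarith

theorem sum_pnat_inv_sqrt_mul_sq_le {c : ℝ} (hc : 0 < c) (D : Finset ℕ+) :
    ∑ d ∈ D, 1 / (√(d : ℝ) * (√(d : ℝ) + c) ^ 2) ≤ 2 / c := by
  have hb : ∀ N : ℕ, ∑ n ∈ Finset.range N,
      1 / (√((n + 1 : ℕ) : ℝ) * (√((n + 1 : ℕ) : ℝ) + c) ^ 2) ≤ 2 / c := fun N => by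
    refine (sum_range_inv_sqrt_mul_sq_le hc N).trans (mul_le_of_le_one_right (by positivity) ?_)
    rw [div_le_one (by positivity)]
    linarith
  have hs := summable_of_sum_range_le (fun n => by positivity) hb
  have hs' : Summable fun d : ℕ+ => 1 / (√(d : ℝ) * (√(d : ℝ) + c) ^ 2) :=
    (summable_pnat_iff_summable_succ
      (f := fun n : ℕ => 1 / (√(n : ℝ) * (√(n : ℝ) + c) ^ 2))).2 hs
  refine (hs'.sum_le_tsum D fun d _ => by positivity).trans ?_
  rw [tsum_pnat_eq_tsum_succ (f := fun n : ℕ => 1 / (√(n : ℝ) * (√(n : ℝ) + c) ^ 2))]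
  exact Real.tsum_le_of_sum_range_le (fun n => by positivity) hb

theorem tsum_prod_le_of_sum_le {ι κ : Type*} {f : ι × κ → ℝ} {b : κ → ℝ} (hf : ∀ p, 0 ≤ f p)
    (hfb : ∀ s, ∀ D : Finset ι, ∑ d ∈ D, f (d, s) ≤ b s) (hb : Summable b) :
    ∑' p, f p ≤ ∑' s, b s := by
  classical
  have hb0 : ∀ s, 0 ≤ b s := fun s => by simpa using hfb s ∅
  refine Real.tsum_le_of_sum_le hf fun F => ?_
  calc ∑ p ∈ F, f p ≤ ∑ p ∈ F.image Prod.fst ×ˢ F.image Prod.snd, f p :=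
        Finset.sum_le_sum_of_subset_of_nonneg Finset.subset_product fun p _ _ => hf p
    _ = ∑ s ∈ F.image Prod.snd, ∑ d ∈ F.image Prod.fst, f (d, s) := Finset.sum_product_right _ _ _
    _ ≤ ∑ s ∈ F.image Prod.snd, b s := Finset.sum_le_sum fun s _ => hfb s _
    _ ≤ ∑' s, b s := hb.sum_le_tsum _ fun s _ => hb0 s

/-- The amplitude of `J` at `x = 4 π s √y / d`, in the normalisation of the cosine series. -/
theorem sqrt_mul_bessel_main_eq {y d s : ℝ} (hy : 0 < y) (hd : 0 < d) (hs : 0 < s) :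
    √y * (√(2 / (Real.pi * (4 * Real.pi * s * √y / d))) / s) =
      y ^ (1 / 4 : ℝ) * (1 / (√2 * Real.pi)) * (√d / s ^ (3 / 2 : ℝ)) := by
  have hy4 : y ^ (1 / 4 : ℝ) = √(√y) := by
    rw [Real.sqrt_eq_rpow, Real.sqrt_eq_rpow, ← Real.rpow_mul hy.le]
    norm_num
  have hq : √(√y) ^ 2 = √y := Real.sq_sqrt (Real.sqrt_nonneg y)
  have hq0 : 0 < √(√y) := Real.sqrt_pos.2 (Real.sqrt_pos.2 hy)
  have harg : √(2 / (Real.pi * (4 * Real.pi * s * √y / d))) =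
      √d / (√2 * Real.pi * √s * √(√y)) := by
    rw [eq_comm, ← Real.sqrt_sq (x := √d / (√2 * Real.pi * √s * √(√y))) (by positivity)]
    congr 1
    simp only [div_pow, mul_pow, hq, Real.sq_sqrt hd.le, Real.sq_sqrt hs.le,
      Real.sq_sqrt zero_le_two]
    field_simp
    norm_num
  rw [harg, hy4, rpow_three_halves hs]
  nth_rw 1 [← hq]
  field_simp

/-- The Bessel series and the cosine series differ by `O(1)`. With `Y = 4 π s √y`, the sum over `d`
of the errors is `O(1 / (s Y))`; the behaviour of the error both below and above `d = Y` matters,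
since `∑ Q(d) d ^ (3/2)` diverges. -/
theorem density_sub_isBigO_one (j : ℕ) :
    (fun y : ℝ => density (2 * j + 2) y -
        y ^ (1 / 4 : ℝ) * ((-1) ^ j * (1 / (√2 * Real.pi)) * alpha) *
          ∑' p : ℕ+ × ℕ+, cosTerm y p.1 p.2)
      =O[atTop] (fun _ : ℝ => (1 : ℝ)) := by
  obtain ⟨C, hC0, hC⟩ := exists_abs_besselJ_odd_sub_le j
  set M := Real.exp (Real.pi ^ 2) with hM
  have hM0 : 0 < M := Real.exp_pos _
  set S := ∑' s : ℕ+, 1 / (s : ℝ) ^ 2 with hS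
  have hSs : Summable fun s : ℕ+ => 1 / (s : ℝ) ^ 2 :=
    (summable_pnat_iff_summable_nat (f := fun n : ℕ => 1 / (n : ℝ) ^ 2)).2
      (Real.summable_one_div_nat_pow.2 one_lt_two)
  refine IsBigO.of_bound (|alpha| * (M * C / (2 * Real.pi) * S)) ?_
  filter_upwards [eventually_gt_atTop 0] with y hy
  have hsy : 0 < √y := Real.sqrt_pos.2 hy
  set κ : ℝ := y ^ (1 / 4 : ℝ) * ((-1) ^ j * (1 / (√2 * Real.pi))) with hκ
  set e : ℕ+ × ℕ+ → ℝ := fun p =>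
    √y * besselTerm (2 * j + 2) y p.1 p.2 - κ * cosTerm y p.1 p.2 with he
  have hb := (summable_abs_besselTerm j hy.le).of_abs
  have hc := (summable_abs_cosTerm y).of_abs
  have hdiff : density (2 * j + 2) y -
      y ^ (1 / 4 : ℝ) * ((-1) ^ j * (1 / (√2 * Real.pi)) * alpha) *
        ∑' p : ℕ+ × ℕ+, cosTerm y p.1 p.2 = alpha * ∑' p, e p := by
    rw [he, (hb.mul_left _).tsum_sub (hc.mul_left _), tsum_mul_left, tsum_mul_left,
      density_eq_tsum j hy.le, hκ]
    ring
  have hes : Summable e := (hb.mul_left _).sub (hc.mul_left _)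
  have heb : ∀ d s : ℕ+, |e (d, s)| ≤ M * C / (s : ℝ) * (√y / √(4 * Real.pi * s * √y)) *
      (1 / (√(d : ℝ) * (√(d : ℝ) + √(4 * Real.pi * s * √y)) ^ 2)) := by
    intro d s
    have hd : (0 : ℝ) < d := by exact_mod_cast d.pos
    have hs : (0 : ℝ) < s := by exact_mod_cast s.pos
    have hsd : 0 < √(d : ℝ) := Real.sqrt_pos.2 hd
    have hx : 0 < 4 * Real.pi * (s : ℝ) * √y / (d : ℝ) := by positivity
    have hQ := Q_nonneg d
    have hmain := sqrt_mul_bessel_main_eq hy hd hs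
    have heq : e (d, s) = √y * (Q d / s) *
        (besselJ (2 * j + 1) (4 * Real.pi * (s : ℝ) * √y / (d : ℝ)) -
          (-1) ^ j * (√(2 / (Real.pi * (4 * Real.pi * (s : ℝ) * √y / (d : ℝ)))) *
            Real.cos (4 * Real.pi * (s : ℝ) * √y / (d : ℝ) - 3 * Real.pi / 4))) := by
      simp only [he, besselTerm_eq, cosTerm, hκ]
      linear_combination ((-1) ^ j * Q d *
        Real.cos (4 * Real.pi * (s : ℝ) * √y / (d : ℝ) - 3 * Real.pi / 4)) * hmain
    rw [heq, abs_mul, abs_of_nonneg (by positivity)]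
    have hsY : 0 < √(4 * Real.pi * s * √y) := Real.sqrt_pos.2 (by positivity)
    have hd2 : √(d : ℝ) ^ 2 = d := Real.sq_sqrt hd.le
    calc _ ≤ √y * (M * (1 / ((d : ℕ) : ℝ) ^ 2) / s) *
          (C / (√(4 * Real.pi * (s : ℝ) * √y / (d : ℝ)) *
            (1 + √(4 * Real.pi * (s : ℝ) * √y / (d : ℝ))) ^ 2)) := by
          gcongr
          · exact Q_le_inv_sq d
          · exact hC _ hx
      _ = _ := by
          rw [Real.sqrt_div (by positivity), ← hd2]
          generalize √(4 * Real.pi * s * √y) = Y at *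
          rw [Real.sqrt_sq hsd.le]
          generalize √(d : ℝ) = a at *
          field_simp
  have hbound : ∑' p, |e p| ≤ ∑' s : ℕ+, M * C / (2 * Real.pi) * (1 / (s : ℝ) ^ 2) := by
    refine tsum_prod_le_of_sum_le (fun p => abs_nonneg _) (fun s D => ?_) (hSs.mul_left _)
    have hs : (0 : ℝ) < s := by exact_mod_cast s.pos
    have hY : 0 < 4 * Real.pi * s * √y := by positivity
    have hsY : 0 < √(4 * Real.pi * s * √y) := Real.sqrt_pos.2 hY
    have hY2 : √(4 * Real.pi * s * √y) ^ 2 = 4 * Real.pi * s * √y := Real.sq_sqrt hY.le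
    calc ∑ d ∈ D, |e (d, s)| ≤ ∑ d ∈ D, M * C / (s : ℝ) * (√y / √(4 * Real.pi * s * √y)) *
          (1 / (√(d : ℝ) * (√(d : ℝ) + √(4 * Real.pi * s * √y)) ^ 2)) :=
          Finset.sum_le_sum fun d _ => heb d s
      _ ≤ M * C / (s : ℝ) * (√y / √(4 * Real.pi * s * √y)) * (2 / √(4 * Real.pi * s * √y)) := by
          rw [← Finset.mul_sum]
          gcongr
          exact sum_pnat_inv_sqrt_mul_sq_le hsY D
      _ = M * C * 2 * √y / (s * √(4 * Real.pi * s * √y) ^ 2) := by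
          field_simp
      _ = _ := by
          rw [hY2]
          field_simp
          norm_num
  rw [hdiff, norm_one, mul_one, norm_mul, Real.norm_eq_abs]
  gcongr
  rw [hS, ← tsum_mul_left]
  exact (norm_tsum_le_tsum_norm hes.norm).trans hbound

theorem tendstoUniformlyOn_sum_cosTerm : TendstoUniformlyOn
    (fun (F : Finset (ℕ+ × ℕ+)) (y : ℝ) => ∑ p ∈ F, cosTerm y p.1 p.2)
    (fun y : ℝ => ∑' p : ℕ+ × ℕ+, cosTerm y p.1 p.2) atTop (Set.Ici 0) := by
  refine tendstoUniformlyOn_tsum (f := fun (p : ℕ+ × ℕ+) (y : ℝ) => cosTerm y p.1 p.2)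
    summable_Q_mul_sqrt_div fun p y _ => ?_
  rw [Real.norm_eq_abs]
  exact abs_cosTerm_le y p.1 p.2

theorem abs_tsum_cosTerm_le (y : ℝ) : |∑' p : ℕ+ × ℕ+, cosTerm y p.1 p.2| ≤
    ∑' p : ℕ+ × ℕ+, Q p.1 * √(p.1 : ℝ) / (p.2 : ℝ) ^ (3 / 2 : ℝ) := by
  refine tsum_of_norm_bounded (f := fun p : ℕ+ × ℕ+ => cosTerm y p.1 p.2)
    summable_Q_mul_sqrt_div.hasSum fun p => ?_
  rw [Real.norm_eq_abs]
  exact abs_cosTerm_le y p.1 p.2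

end CosineSeries

end Murmuration

theorem theorem3 (k : ℕ) (hk : Even k) (hk0 : 0 < k) :
    -- the Bessel expansion, an absolutely convergent double series
    (∀ y : ℝ, 0 ≤ y →
      Summable (fun p : ℕ+ × ℕ+ => |Murmuration.besselTerm k y p.1 p.2|) ∧
      Murmuration.density k y =
        Murmuration.alpha * √y * ∑' p : ℕ+ × ℕ+, Murmuration.besselTerm k y p.1 p.2) ∧
    -- the order of magnitude of `Q`
    (∃ c C : ℝ, 0 < c ∧ 0 < C ∧ ∀ d : ℕ, 1 ≤ d →
      c * ((ArithmeticFunction.moebius d : ℝ) ^ 2 / (d : ℝ) ^ 2) ≤ Murmuration.Q d ∧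
      Murmuration.Q d ≤ C * ((ArithmeticFunction.moebius d : ℝ) ^ 2 / (d : ℝ) ^ 2)) ∧
    -- the asymptotics as `y → ∞`
    (fun y : ℝ => Murmuration.density k y -
        y ^ (1 / 4 : ℝ) * ((-1) ^ (k / 2 - 1) * (1 / (√2 * Real.pi)) * Murmuration.alpha) *
          ∑' p : ℕ+ × ℕ+, Murmuration.cosTerm y p.1 p.2)
      =O[atTop] (fun _ : ℝ => (1 : ℝ)) ∧
    -- the cosine series converges absolutely, uniformly in `y`, and has a bounded sum
    (∀ y : ℝ, 0 ≤ y → Summable (fun p : ℕ+ × ℕ+ => |Murmuration.cosTerm y p.1 p.2|)) ∧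
    TendstoUniformlyOn
      (fun (F : Finset (ℕ+ × ℕ+)) (y : ℝ) => ∑ p ∈ F, Murmuration.cosTerm y p.1 p.2)
      (fun y : ℝ => ∑' p : ℕ+ × ℕ+, Murmuration.cosTerm y p.1 p.2) atTop (Set.Ici 0) ∧
    (∃ B : ℝ, ∀ y : ℝ, 0 ≤ y → |∑' p : ℕ+ × ℕ+, Murmuration.cosTerm y p.1 p.2| ≤ B) := by
  obtain ⟨j, rfl⟩ : ∃ j : ℕ, k = 2 * j + 2 := by
    obtain ⟨m, rfl⟩ := hk
    exact ⟨m - 1, by omega⟩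
  have hj : (2 * j + 2) / 2 - 1 = j := by omega
  rw [hj]
  refine ⟨fun y hy => ⟨Murmuration.summable_abs_besselTerm j hy, Murmuration.density_eq_tsum j hy⟩,
    ⟨1, Real.exp (Real.pi ^ 2), one_pos, Real.exp_pos _, fun d _ =>
      ⟨by simpa using Murmuration.moebius_sq_div_sq_le_Q d, Murmuration.Q_le_moebius_sq_div_sq d⟩⟩,
    Murmuration.density_sub_isBigO_one j, fun y _ => Murmuration.summable_abs_cosTerm y,
    Murmuration.tendstoUniformlyOn_sum_cosTerm, _, fun y _ => Murmuration.abs_tsum_cosTerm_le y⟩
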